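/- Let $G$ be a smooth (possibly infinite-dimensional, Banach) Lie group with Lie algebra $\mathfrak g$, acting smoothly from the right on a smooth (Banach) manifold $M$, and let $\pi\colon P\to M$ be a smooth principal $\mathbb C^*$-bundle (equivalently, $P=L^+$ is the frame bundle of a complex line bundle $L$ on $M$) with a connection $1$-form $A$. No lift of the $G$-action to $P$ is assumed. For $\xi\in\mathfrak g$ let $\hat\xi$ be the fundamental vector field on $M$ and let $(\xi\cdot f)(x)=\frac{d}{dt}\big|_{t=0}f(x\exp(t\xi))$ for $f\in\mathrm{Map}(M,\mathbb C)=C^\infty(M,\mathbb C)$. Let $\widehat G$ be the group of pairs $(g,\varphi)$, where $g\in G$ and $\varphi$ is a $\mathbb C^*$-equivariant diffeomorphism of $P$ covering the action of $g$ on $M$; it acts on $P$ from the right, so that the product is $p\cdot(ab)=(p\cdot a)\cdot b$. The projection $\widehat G\to G$ has kernel $\mathrm{Map}(M,\mathbb C^*)$. Let $\sigma$ be a local section of $\widehat G\to G$ defined on an open neighbourhood of $1\in G$, with $\sigma(1)=1$, smooth in the sense that $(p,g)\mapsto p\cdot\sigma(g)$ is smooth. For $\xi\in\mathfrak g$ let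 $\widehat{d\sigma(\xi)}$ be the vector field on $P$ whose value at $p$ is the derivative of $g\mapsto p\cdot\sigma(g)$ at $1$ in the direction $\xi$. Then: 1. There is a unique $2$-form $F$ on $M$ with $\pi^*F=dA$ (the curvature). Put $\omega_G(\xi,\eta)=-F(\hat\xi,\hat\eta)$. 2. There is a unique linear map $b\colon\mathfrak g\to\mathrm{Map}(M,\mathbb C)$ with $b(\xi)(\pi(p))=A_p\big(\widehat{d\sigma(\xi)}_p\big)$ for all $p\in P$; that is, $b(\xi)=A(\widehat{d\sigma(\xi)})$ descends to a smooth function on $M$. 3. There is a unique bilinear map $\omega_A\colon\mathfrak g\times\mathfrak g\to\mathrm{Map}(M,\mathbb C)$ with $$\frac{\partial^2}{\partial s\,\partial t}\Big|_{s=t=0}\sigma(e^{t\xi})\,\sigma(e^{s\eta})\,\sigma(e^{-t\xi})\,\sigma(e^{-s\eta})=([\xi,\eta],\,\omega_A(\xi,\eta))$$ in the splitting $\mathrm{Lie}(\widehat G)=\mathfrak g\oplus\mathrm{Map}(M,\mathbb C)$ defined by $d\sigma$; that is, for every $p\in P$ the mixed derivative at $s=t=0$ of $p\cdot\sigma(e^{t\xi})\sigma(e^{s\eta})\sigma(e^{-t\xi})\sigma(e^{-s\eta})$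 exists and is $\widehat{d\sigma([\xi,\eta])}_p$ plus the vertical vector at $p$ generated by $\omega_A(\xi,\eta)(\pi(p))\in\mathbb C=\mathrm{Lie}(\mathbb C^*)$. 4. The maps $\omega_G$ and $\omega_A$ differ by the coboundary of $b$: for all $\xi,\eta\in\mathfrak g$, $$\omega_A(\xi,\eta)=\omega_G(\xi,\eta)+\xi\cdot b(\eta)-\eta\cdot b(\xi)-b([\xi,\eta]).$$ -/

import Mathlib

open scoped Manifold ContDiff Topology RightActions
open Set

/-! ### One-parameter subgroups of a Lie group -/

section OneParameter

variable {EG : Type*} [NormedAddCommGroup EG] [NormedSpace ℝ EG] [CompleteSpace EG]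
  {HG : Type*} [TopologicalSpace HG] {IG : ModelWithCorners ℝ EG HG} [IG.Boundaryless]
  {G : Type*} [TopologicalSpace G] [ChartedSpace HG G] [Group G] [LieGroup IG ∞ G] [T2Space G]

/-- Left translation preserves left-invariant vector fields. -/
theorem mfderiv_mul_left_mulInvariantVectorField {EG : Type*} [NormedAddCommGroup EG]
    [NormedSpace ℝ EG] {HG : Type*} [TopologicalSpace HG] {IG : ModelWithCorners ℝ EG HG}
    {G : Type*} [TopologicalSpace G] [ChartedSpace HG G] [Group G] [LieGroup IG ∞ G]
    (ξ : GroupLieAlgebra IG G) (h g : G) :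
    mfderiv IG IG (fun x : G => h * x) g (mulInvariantVectorField ξ g) =
      (mulInvariantVectorField ξ (h * g) : TangentSpace IG (h * g)) := by
  have hd : ∀ a b : G, MDifferentiableAt IG IG (fun x : G => a * x) b := fun a b =>
    (contMDiff_mul_left (I := IG) (n := ∞) (a := a)).contMDiffAt.mdifferentiableAt (by simp)
  have D : (fun x : G => h * g * x) = (fun x => h * x) ∘ fun x => g * x := by
    ext x; simp [mul_assoc]
  have key : mfderiv IG IG (fun x : G => h * g * x) 1 =
      (mfderiv IG IG (fun x : G => h * x) (g * 1)).comp (mfderiv IG IG (fun x : G => g * x) 1) := by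
    rw [D]; exact mfderiv_comp (I' := IG) 1 (hd _ _) (hd _ _)
  have : mulInvariantVectorField ξ (h * g) =
    (mfderiv IG IG (fun x : G => h * x) (g * 1)) (mfderiv IG IG (fun x : G => g * x) 1 ξ) :=
    DFunLike.congr_fun key ξ
  rw [this, mul_one]; rfl

/-- A left-invariant vector field on a Lie group has an integral curve through the identity that is
defined for all times. -/
theorem exists_oneParameterSubgroup (ξ : GroupLieAlgebra IG G) :
    ∃ c : ℝ → G, c 0 = 1 ∧
      IsMIntegralCurve c (fun g : G => (mulInvariantVectorField ξ g : TangentSpace IG g)) := by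
  have : LieGroup IG (minSmoothness ℝ 3) G :=
    LieGroup.of_le (n := ∞) (by simp only [minSmoothness_of_isRCLikeNormedField]; exact ENat.LEInfty.out)
  have : IsManifold IG ∞ G := inferInstance
  have hv : ContMDiff IG IG.tangent 1
      (fun g : G => (⟨g, mulInvariantVectorField ξ g⟩ : TangentBundle IG G)) :=
    (contMDiff_mulInvariantVectorField (I := IG) ξ).of_le
      (le_trans (by norm_num) le_minSmoothness)
  obtain ⟨γ, hγ0, hγ⟩ := exists_isMIntegralCurveAt_of_contMDiffAt_boundaryless (I := IG) 0
    (hv.contMDiffAt (x := (1 : G)))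
  obtain ⟨ε, hε, hγ⟩ := isMIntegralCurveAt_iff'.1 hγ
  refine exists_isMIntegralCurve_of_isMIntegralCurveOn hv hε (fun h => ?_) 1
  refine ⟨fun t => h * γ t, by simp [hγ0], fun t ht => ?_⟩
  have h1 := hγ t (by simpa [Real.ball_eq_Ioo] using ht)
  rw [Real.ball_eq_Ioo, zero_sub, zero_add] at h1
  have h2 : HasMFDerivAt IG IG (fun x : G => h * x) (γ t) (mfderiv IG IG (fun x => h * x) (γ t)) :=
    ((contMDiff_mul_left (I := IG) (n := ∞) (a := h)).contMDiffAt.mdifferentiableAt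
      (by simp)).hasMFDerivAt
  have h3 := h2.comp_hasMFDerivWithinAt t h1
  refine h3.congr_mfderiv ?_
  refine ContinuousLinearMap.ext fun r => ?_
  have h4 := (mfderiv IG IG (fun x : G => h * x) (γ t)).map_smul r (mulInvariantVectorField ξ (γ t))
  rw [mfderiv_mul_left_mulInvariantVectorField ξ h (γ t)] at h4
  exact h4

/-- The one-parameter subgroup `t ↦ exp (t ξ)` of `G`, i.e. the integral curve through `1` of the
left-invariant vector field determined by `ξ`. -/
noncomputable def expCurve (ξ : GroupLieAlgebra IG G) : ℝ → G :=
  Classical.choose (exists_oneParameterSubgroup ξ)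

end OneParameter

/-! ### Principal `ℂˣ`-bundles and connections -/

section Bundles

variable {EM : Type*} [NormedAddCommGroup EM] [NormedSpace ℝ EM]
  {HM : Type*} [TopologicalSpace HM] (I : ModelWithCorners ℝ EM HM)
  {M : Type*} [TopologicalSpace M] [ChartedSpace HM M]
  {EP : Type*} [NormedAddCommGroup EP] [NormedSpace ℝ EP]
  {HP : Type*} [TopologicalSpace HP] (J : ModelWithCorners ℝ EP HP)
  {P : Type*} [TopologicalSpace P] [ChartedSpace HP P]

/-- `π : P → M` is a smooth principal `ℂˣ`-bundle. As `ℂˣ` is commutative, its right action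
on `P` is written as a left action. -/
structure IsPrincipalCStarBundle [MulAction ℂˣ P] (π : P → M) : Prop where
  contMDiff_proj : ContMDiff J I ∞ π
  contMDiff_smul : ContMDiff (𝓘(ℝ, ℂ).prod J) J ∞ (fun q : ℂˣ × P => q.1 • q.2)
  proj_smul : ∀ (z : ℂˣ) (p : P), π (z • p) = π p
  /-- Every point of `M` has an open neighbourhood `U` with an equivariant diffeomorphism
  from `π ⁻¹ (U)` onto `U × ℂˣ` over `U`. -/
  locally_trivial : ∀ x : M, ∃ U : Set M, IsOpen U ∧ x ∈ U ∧
    ∃ e : OpenPartialHomeomorph P (M × ℂˣ),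
      e.source = π ⁻¹' U ∧ e.target = U ×ˢ univ ∧
      ContMDiffOn J (I.prod 𝓘(ℝ, ℂ)) ∞ e e.source ∧
      ContMDiffOn (I.prod 𝓘(ℝ, ℂ)) J ∞ e.symm e.target ∧
      (∀ p ∈ e.source, (e p).1 = π p) ∧
      ∀ p ∈ e.source, ∀ z : ℂˣ, (e (z • p)).2 = z * (e p).2

/-- The fundamental vertical vector field on `P` generated by `z ∈ ℂ = Lie(ℂˣ)`: the velocity at
`1` in direction `z` of the orbit map `lam ↦ lam • p`. -/
noncomputable def vertField [MulAction ℂˣ P] (z : ℂ) (p : P) : TangentSpace J p :=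
  mfderiv 𝓘(ℝ, ℂ) J (fun lam : ℂˣ => lam • p) 1 z

/-- A connection `1`-form on a principal `ℂˣ`-bundle with total space `P`: a smooth `ℂ`-valued
`1`-form on `P`, invariant under `ℂˣ` and reproducing the generators of the vertical fields. -/
structure ConnectionForm (P : Type*) [TopologicalSpace P] [ChartedSpace HP P] [IsManifold J 1 P]
    [MulAction ℂˣ P] where
  form : ∀ p : P, TangentSpace J p →L[ℝ] Bundle.Trivial P ℂ p
  contMDiff_form : ContMDiff J (J.prod 𝓘(ℝ, EP →L[ℝ] ℂ)) ∞
    (fun p => Bundle.TotalSpace.mk' (EP →L[ℝ] ℂ)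
      (E := fun p : P => TangentSpace J p →L[ℝ] Bundle.Trivial P ℂ p) p (form p))
  form_vertField : ∀ (z : ℂ) (p : P), form p (vertField J z p) = z
  form_smul : ∀ (lam : ℂˣ) (p : P) (v : TangentSpace J p),
    form (lam • p) (mfderiv J J (fun q : P => lam • q) p v) = form p v

/-- The exterior derivative at `p` of a `ℂ`-valued `1`-form `A` on `P`, computed in the preferred
chart at `p` (which identifies `TangentSpace J p` with the model space `EP`):
`dA (u, v) = ∂_u (A v) - ∂_v (A u)` for constant `u`, `v`. -/
noncomputable def extDerivOneForm (A : ∀ p : P, TangentSpace J p →L[ℝ] ℂ) (p : P)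
    (u v : TangentSpace J p) : ℂ :=
  let a : EP → EP →L[ℝ] ℂ := fun y =>
    (A ((extChartAt J p).symm y)).comp (mfderiv 𝓘(ℝ, EP) J (extChartAt J p).symm y)
  fderiv ℝ a (extChartAt J p p) u v - fderiv ℝ a (extChartAt J p p) v u

/-- `F` is the curvature of the connection form `A`: the `2`-form on `M` whose pullback to `P`
is `dA`. -/
def IsCurvature [IsManifold J 1 P] [MulAction ℂˣ P] (π : P → M) (A : ConnectionForm J P)
    (F : ∀ x : M, TangentSpace I x →L[ℝ] TangentSpace I x →L[ℝ] ℂ) : Prop :=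
  ∀ (p : P) (u v : TangentSpace J p),
    F (π p) (mfderiv J I π p u) (mfderiv J I π p v) = extDerivOneForm J A.form p u v

/-- For a family `(t, s) ↦ u t s` of points of `P` with `u 0 0 = p` whose first partial derivatives
at `(0, 0)` vanish, `v` is the tangent vector `∂²u/∂s∂t` at `s = t = 0`. It is read in the preferred
chart at `p`; as the first derivatives vanish, it does not depend on the chart. -/
def HasMixedDeriv (u : ℝ → ℝ → P) (p : P) (v : TangentSpace J p) : Prop :=
  ∃ w : ℝ → EP,
    (∀ᶠ s in 𝓝 (0 : ℝ), HasDerivAt (fun t => extChartAt J p (u t s)) (w s) 0) ∧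
    HasDerivAt w (v : EP) 0

end Bundles

/-! ### Infinitesimal action -/

section Action

variable {EG : Type*} [NormedAddCommGroup EG] [NormedSpace ℝ EG]
  {HG : Type*} [TopologicalSpace HG] {IG : ModelWithCorners ℝ EG HG}
  {G : Type*} [TopologicalSpace G] [ChartedSpace HG G] [Group G]
  {EM : Type*} [NormedAddCommGroup EM] [NormedSpace ℝ EM]
  {HM : Type*} [TopologicalSpace HM] (I : ModelWithCorners ℝ EM HM)
  {M : Type*} [TopologicalSpace M] [ChartedSpace HM M] [MulAction Gᵐᵒᵖ M]

/-- The fundamental vector field on `M` generated by `ξ ∈ Lie(G)`, for a right action of `G`: the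
velocity at `1` in direction `ξ` of the orbit map `g ↦ x g`. -/
noncomputable def fundField (ξ : GroupLieAlgebra IG G) (x : M) : TangentSpace I x :=
  (mfderiv IG I (fun g : G => x <• g) 1 ξ : EM)

/-- The action of `ξ ∈ Lie(G)` on functions: `(ξ · f)(x) = d/dt f(x exp(tξ))` at `t = 0`. -/
noncomputable def lieAct [CompleteSpace EG] [IG.Boundaryless] [LieGroup IG ∞ G] [T2Space G]
    (ξ : GroupLieAlgebra IG G) (f : M → ℂ) (x : M) : ℂ :=
  deriv (fun t : ℝ => f (x <• expCurve ξ t)) 0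

end Action

/-! ### The extension of `G` by bundle automorphisms -/

section Extension

variable {EG : Type*} [NormedAddCommGroup EG] [NormedSpace ℝ EG]
  {HG : Type*} [TopologicalSpace HG] (IG : ModelWithCorners ℝ EG HG)
  (G : Type*) [TopologicalSpace G] [ChartedSpace HG G] [Group G]
  {EM : Type*} [NormedAddCommGroup EM] [NormedSpace ℝ EM]
  {HM : Type*} [TopologicalSpace HM] (I : ModelWithCorners ℝ EM HM)
  {M : Type*} [TopologicalSpace M] [ChartedSpace HM M] [MulAction Gᵐᵒᵖ M]
  {EP : Type*} [NormedAddCommGroup EP] [NormedSpace ℝ EP]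
  {HP : Type*} [TopologicalSpace HP] (J : ModelWithCorners ℝ EP HP)
  {P : Type*} [TopologicalSpace P] [ChartedSpace HP P] [MulAction ℂˣ P]

/-- The group `Ĝ` of automorphisms of the principal `ℂˣ`-bundle `π : P → M` covering the right
action of `G` on `M`: pairs of `g ∈ G` and an equivariant diffeomorphism of `P` covering the
action of `g`. It acts on `P` from the right. -/
@[ext] structure CoveringAut (π : P → M) where
  base : G
  diffeo : P ≃ₘ^∞⟮J, J⟯ P
  equivariant : ∀ (z : ℂˣ) (p : P), diffeo (z • p) = z • diffeo p
  covers : ∀ p : P, π (diffeo p) = π p <• base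

namespace CoveringAut

variable {G J}
variable {π : P → M}

noncomputable instance : One (CoveringAut G J π) :=
  ⟨⟨1, Diffeomorph.refl J P ∞, fun _ _ => rfl, fun p => by simp⟩⟩

/-- The product `a b` acts on `P` by `p (a b) = (p a) b`. -/
noncomputable instance : Mul (CoveringAut G J π) :=
  ⟨fun a b => ⟨a.base * b.base, a.diffeo.trans b.diffeo,
    fun z p => by simp [a.equivariant, b.equivariant],
    fun p => by simp [a.covers, b.covers, mul_smul]⟩⟩

noncomputable instance : Inv (CoveringAut G J π) :=
  ⟨fun a => ⟨a.base⁻¹, a.diffeo.symm,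
    fun z p => a.diffeo.injective (by simp [a.equivariant]),
    fun p => by
      have h := a.covers (a.diffeo.symm p)
      rw [Diffeomorph.apply_symm_apply] at h
      rw [h, smul_smul, ← MulOpposite.op_mul]; simp⟩⟩

noncomputable instance : Group (CoveringAut G J π) where
  mul_assoc a b c := by
    ext1
    · exact mul_assoc _ _ _
    · rfl
  one_mul a := by
    ext1
    · exact one_mul _
    · rfl
  mul_one a := by
    ext1
    · exact mul_one _
    · rfl
  inv_mul_cancel a := by
    ext1
    · exact inv_mul_cancel _
    · exact Diffeomorph.ext fun p => a.diffeo.apply_symm_apply p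

end CoveringAut

/-- A smooth local section of `Ĝ → G`, defined on an open neighbourhood `dom` of `1` and with
`σ(1) = 1`. Smoothness means that `(p, g) ↦ p σ(g)` is smooth. Values outside `dom` play no
role. -/
structure LocalSection (π : P → M) where
  toFun : G → CoveringAut G J π
  dom : Set G
  isOpen_dom : IsOpen dom
  one_mem_dom : 1 ∈ dom
  base_toFun : ∀ g ∈ dom, (toFun g).base = g
  map_one : toFun 1 = 1
  contMDiffOn : ContMDiffOn (J.prod IG) J ∞ (fun q : P × G => (toFun q.2).diffeo q.1) (univ ×ˢ dom)

namespace LocalSection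

variable {IG G J}
variable {π : P → M}

/-- The fundamental vector field on `P` generated by `dσ(ξ) ∈ Lie(Ĝ)`: the velocity at `1` in
direction `ξ` of `g ↦ p σ(g)`. -/
noncomputable def field (σ : LocalSection IG G J π) (ξ : GroupLieAlgebra IG G) (p : P) :
    TangentSpace J p :=
  (mfderiv IG J (fun g : G => (σ.toFun g).diffeo p) 1 ξ : EP)

variable {I}

/-- `b` is the `1`-cochain `b(ξ) = A(fundamental vector field of dσ(ξ))`, a function on `P`
regarded as a function on `M`. -/
def IsConnectionCochain [IsManifold J 1 P] (σ : LocalSection IG G J π) (A : ConnectionForm J P)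
    (b : GroupLieAlgebra IG G →ₗ[ℝ] C^∞⟮I, M; 𝓘(ℝ, ℂ), ℂ⟯) : Prop :=
  ∀ (ξ : GroupLieAlgebra IG G) (p : P), b ξ (π p) = A.form p (σ.field ξ p)

/-- `om` is the `2`-cocycle defined by the local section `σ`:
`∂²/∂s∂t σ(exp tξ) σ(exp sη) σ(exp(-tξ)) σ(exp(-sη)) = ([ξ, η], om(ξ, η))` at `s = t = 0` in the
splitting `Lie(Ĝ) = Lie(G) ⊕ Map(M, ℂ)` given by `dσ`. Both sides are evaluated on `P`: an element
`(ζ, f)` of the right-hand side acts on `P` as the fundamental field of `dσ(ζ)` plus the vertical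
field which at `p` is generated by `f(π(p))`. -/
def IsSectionCocycle [CompleteSpace EG] [IG.Boundaryless] [LieGroup IG ∞ G] [T2Space G]
    (σ : LocalSection IG G J π)
    (om : GroupLieAlgebra IG G →ₗ[ℝ] GroupLieAlgebra IG G →ₗ[ℝ] C^∞⟮I, M; 𝓘(ℝ, ℂ), ℂ⟯) : Prop :=
  ∀ (ξ η : GroupLieAlgebra IG G) (p : P),
    HasMixedDeriv J
      (fun t s => (σ.toFun (expCurve ξ t) * σ.toFun (expCurve η s) *
        σ.toFun (expCurve ξ (-t)) * σ.toFun (expCurve η (-s))).diffeo p)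
      p (σ.field ⁅ξ, η⁆ p + vertField J (om ξ η (π p)) p)

end LocalSection

end Extension

/-!
The fundamental fields of `dσ(ξ)` and `dσ(η)` on `P` lift those of `ξ` and `η` on `M`, and the mixed
derivative of the group commutator of the curves `σ(exp tξ)`, `σ(exp sη)` is their Lie bracket. That
bracket and the field of `dσ([ξ, η])` both lift the fundamental field of `[ξ, η]`, so they differ by
a vertical vector, which the connection form detects. Since `A` takes the values `b(ξ)`, `b(η)` and
`b([ξ, η])` on the three fields, the identity `dA(V, W) = V(A W) - W(A V) - A([V, W])` expresses it
through `b` and the curvature: this is the cocycle formula.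

The curvature `F` exists because locally `P` has sections `s`, and `A` differs from its pullback
along `s ∘ π` by the closed form `dℓ`, where `p = exp(ℓ p) s(π p)`.
-/

section Calculus

open VectorField

variable {𝕜 : Type*} [NontriviallyNormedField 𝕜]
  {E : Type*} [NormedAddCommGroup E] [NormedSpace 𝕜 E]
  {F : Type*} [NormedAddCommGroup F] [NormedSpace 𝕜 F]
  {n : ℕ∞ω}

theorem fderiv_lieBracket_of_related {g : E → F} {x : E} {V W : E → E} {V' W' : F → F}
    (hg : ContDiffAt 𝕜 n g x) (hn : minSmoothness 𝕜 2 ≤ n)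
    (hV : DifferentiableAt 𝕜 V x) (hW : DifferentiableAt 𝕜 W x)
    (hV' : DifferentiableAt 𝕜 V' (g x)) (hW' : DifferentiableAt 𝕜 W' (g x))
    (relV : (fun y => fderiv 𝕜 g y (V y)) =ᶠ[𝓝 x] fun y => V' (g y))
    (relW : (fun y => fderiv 𝕜 g y (W y)) =ᶠ[𝓝 x] fun y => W' (g y)) :
    fderiv 𝕜 g x (lieBracket 𝕜 V W x) = lieBracket 𝕜 V' W' (g x) := by
  have hgx : DifferentiableAt 𝕜 g x :=
    (hg.of_le (le_minSmoothness.trans hn)).differentiableAt (by simp)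
  rw [fderiv_apply_lieBracket hg hn hW hV, relV.fderiv_eq, relW.fderiv_eq,
    fderiv_fun_comp x hV' hgx, fderiv_fun_comp x hW' hgx]
  simp only [ContinuousLinearMap.comp_apply, relV.self_of_nhds, relW.self_of_nhds, lieBracket]

/-- The exterior derivative of a `1`-form `a` on a normed space, as a bilinear map:
`(u, v) ↦ ∂_u (a v) - ∂_v (a u)` for constant `u` and `v`. -/
noncomputable def extDerivLinear (a : E → E →L[𝕜] F) (x : E) : E →L[𝕜] E →L[𝕜] F :=
  fderiv 𝕜 a x - (fderiv 𝕜 a x).flip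

theorem extDerivLinear_apply (a : E → E →L[𝕜] F) (x u v : E) :
    extDerivLinear a x u v = fderiv 𝕜 a x u v - fderiv 𝕜 a x v u :=
  rfl

theorem extDerivLinear_congr {a b : E → E →L[𝕜] F} {x : E} (h : a =ᶠ[𝓝 x] b) :
    extDerivLinear a x = extDerivLinear b x := by
  rw [extDerivLinear, extDerivLinear, h.fderiv_eq]

theorem extDerivLinear_fderiv_add {f : E → F} {a : E → E →L[𝕜] F} {x : E}
    (hf : ContDiffAt 𝕜 n f x) (hn : minSmoothness 𝕜 2 ≤ n) (ha : DifferentiableAt 𝕜 a x) :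
    extDerivLinear (fun z => fderiv 𝕜 f z + a z) x = extDerivLinear a x := by
  have hdf : DifferentiableAt 𝕜 (fderiv 𝕜 f) x :=
    ((hf.of_le (le_minSmoothness.trans hn)).fderiv_right (m := 1) (by norm_num)).differentiableAt
      one_ne_zero
  ext u v
  rw [extDerivLinear_apply, extDerivLinear_apply, fderiv_fun_add hdf ha, add_apply, add_apply,
    add_apply, add_apply, hf.isSymmSndFDerivAt hn u v, add_sub_add_left_eq_sub]

theorem extDerivLinear_apply_vectorField {a : E → E →L[𝕜] F} {x : E} {V W : E → E}
    (ha : DifferentiableAt 𝕜 a x) (hV : DifferentiableAt 𝕜 V x) (hW : DifferentiableAt 𝕜 W x) :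
    extDerivLinear a x (V x) (W x) = fderiv 𝕜 (fun y => a y (W y)) x (V x) -
      fderiv 𝕜 (fun y => a y (V y)) x (W x) - a x (lieBracket 𝕜 V W x) := by
  rw [extDerivLinear_apply, fderiv_clm_apply ha hV, fderiv_clm_apply ha hW, lieBracket, map_sub]
  simp only [add_apply, ContinuousLinearMap.comp_apply, ContinuousLinearMap.flip_apply]
  abel

theorem differentiableAt_pullback {E' : Type*} [NormedAddCommGroup E'] [NormedSpace 𝕜 E']
    {a : E → E →L[𝕜] F} {φ : E' → E} {y : E'} (ha : DifferentiableAt 𝕜 a (φ y))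
    (hφ : ContDiffAt 𝕜 2 φ y) :
    DifferentiableAt 𝕜 (fun z => (a (φ z)).comp (fderiv 𝕜 φ z)) y :=
  (ha.comp y (hφ.differentiableAt (by simp))).clm_comp
    ((hφ.fderiv_right (m := 1) (by norm_num)).differentiableAt (by simp))

theorem extDerivLinear_pullback {E' : Type*} [NormedAddCommGroup E'] [NormedSpace 𝕜 E']
    {a : E → E →L[𝕜] F} {φ : E' → E} {y : E'} (ha : DifferentiableAt 𝕜 a (φ y))
    (hφ : ContDiffAt 𝕜 n φ y) (hn : minSmoothness 𝕜 2 ≤ n) (u v : E') :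
    extDerivLinear (fun z => (a (φ z)).comp (fderiv 𝕜 φ z)) y u v =
      extDerivLinear a (φ y) (fderiv 𝕜 φ y u) (fderiv 𝕜 φ y v) := by
  have hφ₂ : ContDiffAt 𝕜 2 φ y := hφ.of_le (le_minSmoothness.trans hn)
  have hφ₁ : DifferentiableAt 𝕜 φ y := hφ₂.differentiableAt (by simp)
  have hdφ : DifferentiableAt 𝕜 (fderiv 𝕜 φ) y :=
    (hφ₂.fderiv_right (m := 1) (by norm_num)).differentiableAt (by simp)
  have hsymm := (hφ.isSymmSndFDerivAt hn).eq u v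
  rw [extDerivLinear_apply, extDerivLinear_apply, fderiv_clm_comp (ha.fun_comp' y hφ₁) hdφ,
    fderiv_fun_comp y ha hφ₁]
  simp only [add_apply, ContinuousLinearMap.comp_apply, ContinuousLinearMap.compL_apply,
    ContinuousLinearMap.flip_apply, hsymm]
  abel

variable (𝕜) in
/-- The infinitesimal generator in direction `ξ` of a local action `S` of a neighbourhood of `h₀`
(which acts as the identity) on a normed space. -/
noncomputable def generator (S : E × F → F) (h₀ ξ : E) (y : F) : F :=
  fderiv 𝕜 S (h₀, y) (ξ, 0)

theorem fderiv_inr_eq_self {S : E × F → F} {h₀ : E} {y : F}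
    (hS : DifferentiableAt 𝕜 S (h₀, y)) (hid : ∀ᶠ z in 𝓝 y, S (h₀, z) = z) (v : F) :
    fderiv 𝕜 S (h₀, y) (0, v) = v := by
  have h₁ : HasFDerivAt (fun z => S (h₀, z)) _ y :=
    hS.hasFDerivAt.comp y (hasFDerivAt_prodMk_right h₀ y)
  have h₂ : HasFDerivAt (fun z => S (h₀, z)) (.id 𝕜 F) y :=
    (hasFDerivAt_id y).congr_of_eventuallyEq hid
  simpa using DFunLike.congr_fun (h₁.unique h₂) v

theorem hasFDerivAt_generator {S : E × F → F} {h₀ : E} {y : F}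
    (hS : DifferentiableAt 𝕜 (fderiv 𝕜 S) (h₀, y)) (ξ : E) :
    HasFDerivAt (generator 𝕜 S h₀ ξ)
      (((fderiv 𝕜 (fderiv 𝕜 S) (h₀, y)).comp (.inr 𝕜 E F)).flip (ξ, 0)) y := by
  have h := (hS.hasFDerivAt.comp y (hasFDerivAt_prodMk_right h₀ y)).clm_apply
    (hasFDerivAt_const ((ξ, 0) : E × F) y)
  exact h.congr_fderiv (by ext; simp)

theorem hasDerivAt_neg_comp {α : 𝕜 → E} {ξ : E} (hα : HasDerivAt α ξ 0) :
    HasDerivAt (fun t => α (-t)) (-ξ) 0 := by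
  simpa [Function.comp_def] using HasDerivAt.scomp_of_eq (0 : 𝕜) hα (hasDerivAt_neg 0) neg_zero.symm

variable {S : E × F → F} {h₀ : E} {y₀ : F} {α β : 𝕜 → E} {ξ η : E}

/-- The points `b` and `b'` stand for `β s` and `β (-s)` at a fixed time `s`. -/
theorem hasDerivAt_commutator_const {b b' : E} (hα : HasDerivAt α ξ 0) (hα₀ : α 0 = h₀)
    (h₁ : DifferentiableAt 𝕜 S (h₀, y₀)) (h₂ : DifferentiableAt 𝕜 S (b, y₀))
    (h₃ : DifferentiableAt 𝕜 S (h₀, S (b, y₀))) (h₄ : DifferentiableAt 𝕜 S (b', S (b, y₀)))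
    (hy₀ : S (h₀, y₀) = y₀) (hid : ∀ᶠ y in 𝓝 (S (b, y₀)), S (h₀, y) = y) :
    HasDerivAt (fun t => S (b', S (α (-t), S (b, S (α t, y₀)))))
      (fderiv 𝕜 S (b', S (b, y₀)) (0, fderiv 𝕜 S (b, y₀) (0, generator 𝕜 S h₀ ξ y₀) -
        generator 𝕜 S h₀ ξ (S (b, y₀)))) 0 := by
  have f₁ : HasDerivAt (fun t => S (α t, y₀)) (generator 𝕜 S h₀ ξ y₀) 0 :=
    h₁.hasFDerivAt.comp_hasDerivAt_of_eq 0 (hα.prodMk (hasDerivAt_const 0 y₀)) (by rw [hα₀])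
  have f₂ : HasDerivAt (fun t => S (b, S (α t, y₀)))
      (fderiv 𝕜 S (b, y₀) (0, generator 𝕜 S h₀ ξ y₀)) 0 :=
    h₂.hasFDerivAt.comp_hasDerivAt_of_eq 0 ((hasDerivAt_const 0 b).prodMk f₁) (by rw [hα₀, hy₀])
  have f₃ := h₃.hasFDerivAt.comp_hasDerivAt_of_eq 0 ((hasDerivAt_neg_comp hα).prodMk f₂)
    (by simp [hα₀, hy₀])
  have split : ((-ξ, fderiv 𝕜 S (b, y₀) (0, generator 𝕜 S h₀ ξ y₀)) : E × F) =
      (0, fderiv 𝕜 S (b, y₀) (0, generator 𝕜 S h₀ ξ y₀)) - (ξ, 0) := by simp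
  rw [split, map_sub, fderiv_inr_eq_self h₃ hid] at f₃
  exact h₄.hasFDerivAt.comp_hasDerivAt_of_eq 0 ((hasDerivAt_const 0 b').prodMk f₃)
    (by simp [hα₀, hy₀, hid.self_of_nhds])

theorem hasDerivAt_deriv_commutator (hS : ContDiffAt 𝕜 n S (h₀, y₀)) (hn : minSmoothness 𝕜 2 ≤ n)
    (hid : ∀ᶠ y in 𝓝 y₀, S (h₀, y) = y) (hβ : HasDerivAt β η 0) (hβ₀ : β 0 = h₀) :
    HasDerivAt (fun s => fderiv 𝕜 S (β (-s), S (β s, y₀)) (0, fderiv 𝕜 S (β s, y₀)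
        (0, generator 𝕜 S h₀ ξ y₀) - generator 𝕜 S h₀ ξ (S (β s, y₀))))
      (lieBracket 𝕜 (generator 𝕜 S h₀ ξ) (generator 𝕜 S h₀ η) y₀) 0 := by
  have hS₂ : ContDiffAt 𝕜 2 S (h₀, y₀) := hS.of_le (le_minSmoothness.trans hn)
  have hS₁ : DifferentiableAt 𝕜 S (h₀, y₀) := hS₂.differentiableAt (by simp)
  have hdS : DifferentiableAt 𝕜 (fderiv 𝕜 S) (h₀, y₀) :=
    (hS₂.fderiv_right (m := 1) (by norm_num)).differentiableAt (by simp)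
  have hy₀ : S (h₀, y₀) = y₀ := hid.self_of_nhds
  have hc : HasDerivAt (fun s => S (β s, y₀)) (generator 𝕜 S h₀ η y₀) 0 :=
    hS₁.hasFDerivAt.comp_hasDerivAt_of_eq 0 (hβ.prodMk (hasDerivAt_const 0 y₀)) (by rw [hβ₀])
  have hL : HasDerivAt (fun s => fderiv 𝕜 S (β (-s), S (β s, y₀))) _ 0 :=
    hdS.hasFDerivAt.comp_hasDerivAt_of_eq 0 ((hasDerivAt_neg_comp hβ).prodMk hc)
      (by simp [hβ₀, hy₀])
  have hR : HasDerivAt (fun s => fderiv 𝕜 S (β s, y₀)) _ 0 :=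
    hdS.hasFDerivAt.comp_hasDerivAt_of_eq 0 (hβ.prodMk (hasDerivAt_const 0 y₀)) (by rw [hβ₀])
  have hX : HasDerivAt (fun s => generator 𝕜 S h₀ ξ (S (β s, y₀))) _ 0 :=
    (hasFDerivAt_generator hdS ξ).comp_hasDerivAt_of_eq 0 hc (by rw [hβ₀, hy₀])
  refine (hL.clm_apply ((hasDerivAt_const 0 (0 : E)).prodMk
    ((hR.clm_apply (hasDerivAt_const 0 (0, generator 𝕜 S h₀ ξ y₀))).sub hX))).congr_deriv ?_
  have hsymm := (hS.isSymmSndFDerivAt hn).eq (0, generator 𝕜 S h₀ ξ y₀) (η, 0)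
  have hfix : fderiv 𝕜 S (h₀, y₀) (0, generator 𝕜 S h₀ ξ y₀) = generator 𝕜 S h₀ ξ y₀ :=
    fderiv_inr_eq_self hS₁ hid _
  rw [lieBracket, (hasFDerivAt_generator hdS ξ).fderiv, (hasFDerivAt_generator hdS η).fderiv]
  simp only [Pi.sub_apply, hβ₀, neg_zero, hy₀, hfix, sub_self, map_zero, add_zero, zero_add,
    Prod.mk_zero_zero, fderiv_inr_eq_self hS₁ hid, ContinuousLinearMap.comp_apply,
    ContinuousLinearMap.flip_apply, ContinuousLinearMap.inr_apply]
  rw [hsymm]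

theorem hasDerivAt_commutator (hS : ContDiffAt 𝕜 n S (h₀, y₀)) (hn : minSmoothness 𝕜 2 ≤ n)
    (hid : ∀ᶠ y in 𝓝 y₀, S (h₀, y) = y) (hα : HasDerivAt α ξ 0) (hα₀ : α 0 = h₀)
    (hβ : HasDerivAt β η 0) (hβ₀ : β 0 = h₀) :
    ∃ w : 𝕜 → F, (∀ᶠ s in 𝓝 (0 : 𝕜),
      HasDerivAt (fun t => S (β (-s), S (α (-t), S (β s, S (α t, y₀))))) (w s) 0) ∧
      HasDerivAt w (lieBracket 𝕜 (generator 𝕜 S h₀ ξ) (generator 𝕜 S h₀ η) y₀) 0 := by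
  refine ⟨_, ?_, hasDerivAt_deriv_commutator hS hn hid hβ hβ₀⟩
  have hdiff : ∀ᶠ q in 𝓝 (h₀, y₀), DifferentiableAt 𝕜 S q := by
    filter_upwards [(hS.of_le (le_minSmoothness.trans hn)).eventually (by simp)] with q hq
    exact hq.differentiableAt (by simp)
  have hy₀ : S (h₀, y₀) = y₀ := hid.self_of_nhds
  have hc : ContinuousAt (fun s => S (β s, y₀)) 0 :=
    hdiff.self_of_nhds.continuousAt.comp_of_eq (hβ.continuousAt.prodMk continuousAt_const)
      (by simp [hβ₀])
  have hβ' := (hasDerivAt_neg_comp hβ).continuousAt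
  have near₂ := (hβ.continuousAt.prodMk (continuousAt_const (y := y₀))).eventually
    (by simpa [hβ₀] using hdiff)
  have near₃ := ((continuousAt_const (y := h₀)).prodMk hc).eventually
    (by simpa [hβ₀, hy₀] using hdiff)
  have near₄ := (hβ'.prodMk hc).eventually (by simpa [hβ₀, hy₀] using hdiff)
  have fixed : ∀ᶠ s in 𝓝 (0 : 𝕜), ∀ᶠ y in 𝓝 (S (β s, y₀)), S (h₀, y) = y :=
    hc.eventually (p := fun z => ∀ᶠ y in 𝓝 z, S (h₀, y) = y)
      (by simpa only [hβ₀, hy₀] using hid.eventually_nhds)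
  filter_upwards [near₂, near₃, near₄, fixed] with s h₂ h₃ h₄ h
  exact hasDerivAt_commutator_const hα hα₀ hdiff.self_of_nhds h₂ h₃ h₄ hy₀ h

end Calculus

section Charts

open VectorField

variable {E : Type*} [NormedAddCommGroup E] [NormedSpace ℝ E]
  {H : Type*} [TopologicalSpace H] {I : ModelWithCorners ℝ E H}
  {N : Type*} [TopologicalSpace N] [ChartedSpace H N]
  {E' : Type*} [NormedAddCommGroup E'] [NormedSpace ℝ E']
  {H' : Type*} [TopologicalSpace H'] {I' : ModelWithCorners ℝ E' H'}
  {N' : Type*} [TopologicalSpace N'] [ChartedSpace H' N']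
  {F : Type*} [NormedAddCommGroup F] [NormedSpace ℝ F]

variable (I) in
/-- A vector field on a manifold, read in the preferred chart at `p`. -/
noncomputable def vfChart (V : ∀ x : N, TangentSpace I x) (p : N) (y : E) : E :=
  mfderiv I 𝓘(ℝ, E) (extChartAt I p) ((extChartAt I p).symm y) (V ((extChartAt I p).symm y))

variable (I) in
/-- The pullback of a vector-valued `1`-form on a manifold along a map from a normed space. Along
the inverse of a chart, this is the form read in that chart. -/
noncomputable def pullbackForm (A : ∀ x : N, TangentSpace I x →L[ℝ] F) (Φ : E' → N) (y : E') :
    E' →L[ℝ] F :=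
  (A (Φ y)).comp (mfderiv 𝓘(ℝ, E') I Φ y)

theorem extDerivOneForm_eq_extDerivLinear (A : ∀ x : N, TangentSpace I x →L[ℝ] ℂ) (p : N)
    (u v : TangentSpace I p) :
    extDerivOneForm I A p u v =
      extDerivLinear (pullbackForm I A (extChartAt I p).symm) (extChartAt I p p) u v :=
  rfl

theorem pullbackForm_congr (A : ∀ x : N, TangentSpace I x →L[ℝ] F) {Φ Ψ : E' → N} {y : E'}
    (h : Φ =ᶠ[𝓝 y] Ψ) : pullbackForm I A Φ y = pullbackForm I A Ψ y := by
  have hmf : (mfderiv 𝓘(ℝ, E') I Φ y : E' →L[ℝ] E) = mfderiv 𝓘(ℝ, E') I Ψ y := h.mfderiv_eq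
  have hA : (A (Φ y) : E →L[ℝ] F) = A (Ψ y) := by rw [h.self_of_nhds]
  exact congrArg₂ ContinuousLinearMap.comp hA hmf

theorem pullbackForm_comp {E'' : Type*} [NormedAddCommGroup E''] [NormedSpace ℝ E'']
    (A : ∀ x : N, TangentSpace I x →L[ℝ] F) {Φ : E' → N} {φ : E'' → E'} {y : E''}
    (hΦ : MDifferentiableAt 𝓘(ℝ, E') I Φ (φ y)) (hφ : DifferentiableAt ℝ φ y) :
    pullbackForm I A (Φ ∘ φ) y = (pullbackForm I A Φ (φ y)).comp (fderiv ℝ φ y) := by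
  rw [pullbackForm, mfderiv_comp y hΦ hφ.mdifferentiableAt, mfderiv_eq_fderiv]
  rfl

theorem vfChart_extChartAt (V : ∀ x : N, TangentSpace I x) {p q : N}
    (hq : q ∈ (extChartAt I p).source) :
    vfChart I V p (extChartAt I p q) = mfderiv I 𝓘(ℝ, E) (extChartAt I p) q (V q) := by
  rw [vfChart, (extChartAt I p).left_inv hq]

theorem mfderiv_eq_fderiv_extChartAt_comp {Φ : E' → N} {y : E'}
    (h : MDifferentiableAt 𝓘(ℝ, E') I Φ y) :
    (mfderiv 𝓘(ℝ, E') I Φ y : E' →L[ℝ] E) = fderiv ℝ (fun z => extChartAt I (Φ y) (Φ z)) y := by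
  simpa [writtenInExtChartAt, Function.comp_def, chartAt_self_eq] using h.mfderiv

theorem mfderiv_eq_fderiv_writtenInExtChartAt [I.Boundaryless] {f : N → N'} {p : N}
    (hf : MDifferentiableAt I I' f p) :
    (mfderiv I I' f p : E →L[ℝ] E') =
      fderiv ℝ (writtenInExtChartAt I I' p f) (extChartAt I p p) := by
  rw [hf.mfderiv, I.range_eq_univ, fderivWithin_univ]

variable [IsManifold I 1 N]

theorem mfderiv_extChartAt_self_apply (p : N) (v : TangentSpace I p) :
    mfderiv I 𝓘(ℝ, E) (extChartAt I p) p v = v := by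
  rw [mfderiv_extChartAt_self]
  rfl

theorem vfChart_self (V : ∀ x : N, TangentSpace I x) (p : N) :
    vfChart I V p (extChartAt I p p) = V p := by
  rw [vfChart_extChartAt V (mem_extChartAt_source p)]
  exact mfderiv_extChartAt_self_apply p (V p)

variable [I.Boundaryless]

theorem mdifferentiableAt_extChartAt_symm {p : N} {y : E} (hy : y ∈ (extChartAt I p).target) :
    MDifferentiableAt 𝓘(ℝ, E) I (extChartAt I p).symm y :=
  (contMDiffOn_extChartAt_symm (n := 1) p).contMDiffAt
    ((isOpen_extChartAt_target p).mem_nhds hy) |>.mdifferentiableAt one_ne_zero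

theorem mfderiv_extChartAt_symm_mfderiv_extChartAt {p : N} {y : E}
    (hy : y ∈ (extChartAt I p).target) (v : TangentSpace I ((extChartAt I p).symm y)) :
    mfderiv 𝓘(ℝ, E) I (extChartAt I p).symm y
      (mfderiv I 𝓘(ℝ, E) (extChartAt I p) ((extChartAt I p).symm y) v) = v := by
  have h := mfderivWithin_extChartAt_symm_comp_mfderiv_extChartAt hy
  rw [I.range_eq_univ, mfderivWithin_univ] at h
  exact DFunLike.congr_fun h v

theorem mfderiv_extChartAt_symm_self (p : N) :
    (mfderiv 𝓘(ℝ, E) I (extChartAt I p).symm (extChartAt I p p) : E →L[ℝ] E) = .id ℝ E := by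
  rw [← mfderivWithin_univ, ← I.range_eq_univ]
  exact mfderivWithin_range_extChartAt_symm

theorem pullbackForm_extChartAt_symm_self (A : ∀ x : N, TangentSpace I x →L[ℝ] F) (p : N) :
    pullbackForm I A (extChartAt I p).symm (extChartAt I p p) = A p := by
  have hA : (A ((extChartAt I p).symm (extChartAt I p p)) : E →L[ℝ] F) = A p := by
    rw [extChartAt_to_inv]
  exact congrArg₂ ContinuousLinearMap.comp hA (mfderiv_extChartAt_symm_self p)

theorem pullbackForm_extChartAt_symm_vfChart (A : ∀ x : N, TangentSpace I x →L[ℝ] F)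
    (V : ∀ x : N, TangentSpace I x) {p : N} {y : E} (hy : y ∈ (extChartAt I p).target) :
    pullbackForm I A (extChartAt I p).symm y (vfChart I V p y) =
      A ((extChartAt I p).symm y) (V ((extChartAt I p).symm y)) :=
  congrArg (A ((extChartAt I p).symm y)) (mfderiv_extChartAt_symm_mfderiv_extChartAt hy _)

theorem mlieBracket_eq_lieBracket_vfChart (V W : ∀ x : N, TangentSpace I x) (p : N) :
    (mlieBracket I V W p : E) =
      lieBracket ℝ (vfChart I V p) (vfChart I W p) (extChartAt I p p) := by
  have pullback_eq (V : ∀ x : N, TangentSpace I x) :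
      mpullbackWithin 𝓘(ℝ, E) I (extChartAt I p).symm V (range I) =ᶠ[𝓝 (extChartAt I p p)]
        vfChart I V p := by
    filter_upwards [extChartAt_target_mem_nhds p] with y hy
    rw [mpullbackWithin_apply, ContinuousLinearMap.inverse_eq
      (mfderivWithin_extChartAt_symm_comp_mfderiv_extChartAt hy)
      (mfderiv_extChartAt_comp_mfderivWithin_extChartAt_symm hy)]
    rfl
  have inverse_eq : (mfderiv I 𝓘(ℝ, E) (extChartAt I p) p : E →L[ℝ] E).inverse = .id ℝ E :=
    (congrArg ContinuousLinearMap.inverse (mfderiv_extChartAt_self (I := I) (x := p))).trans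
      ContinuousLinearMap.inverse_id
  have bracket_eq {a b : E → E} (ha : a =ᶠ[𝓝 (extChartAt I p p)] vfChart I V p)
      (hb : b =ᶠ[𝓝 (extChartAt I p p)] vfChart I W p) :
      lieBracketWithin ℝ a b ((extChartAt I p).symm ⁻¹' univ ∩ range I) (extChartAt I p p) =
        lieBracket ℝ (vfChart I V p) (vfChart I W p) (extChartAt I p p) := by
    rw [preimage_univ, univ_inter, I.range_eq_univ, lieBracketWithin_univ,
      ha.lieBracket_vectorField_eq hb]
  rw [← mlieBracketWithin_univ, mlieBracketWithin_apply]
  exact (DFunLike.congr_fun inverse_eq _).trans (bracket_eq (pullback_eq V) (pullback_eq W))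

end Charts

section OneForms

variable {E : Type*} [NormedAddCommGroup E] [NormedSpace ℝ E]
  {H : Type*} [TopologicalSpace H] {I : ModelWithCorners ℝ E H}
  {N : Type*} [TopologicalSpace N] [ChartedSpace H N]
  {E' : Type*} [NormedAddCommGroup E'] [NormedSpace ℝ E']
  {F : Type*} [NormedAddCommGroup F] [NormedSpace ℝ F]

theorem contDiffAt_extChartAt_comp {n : ℕ∞ω} {Φ : E' → N} {y : E'}
    (hΦ : ContMDiffAt 𝓘(ℝ, E') I n Φ y) :
    ContDiffAt ℝ n (fun z => extChartAt I (Φ y) (Φ z)) y :=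
  (ContMDiffAt.comp y contMDiffAt_extChartAt hΦ).contDiffAt

variable [I.Boundaryless]

theorem contMDiffAt_extChartAt_symm {n : ℕ∞ω} [IsManifold I n N] {p : N} {y : E}
    (hy : y ∈ (extChartAt I p).target) :
    ContMDiffAt 𝓘(ℝ, E) I n (extChartAt I p).symm y :=
  (contMDiffOn_extChartAt_symm p).contMDiffAt (extChartAt_target_mem_nhds' hy)

theorem contDiffAt_pullbackForm_extChartAt_symm {n : ℕ∞ω} [IsManifold I 1 N] [IsManifold I n N]
    {A : ∀ p : N, TangentSpace I p →L[ℝ] Bundle.Trivial N F p} {p : N}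
    (hA : ContMDiffAt I (I.prod 𝓘(ℝ, E →L[ℝ] F)) n
      (fun p => Bundle.TotalSpace.mk' (E →L[ℝ] F)
        (E := fun p : N => TangentSpace I p →L[ℝ] Bundle.Trivial N F p) p (A p)) p) :
    ContDiffAt ℝ n (pullbackForm I (F := F) A (extChartAt I p).symm) (extChartAt I p p) := by
  have hcoord : ContDiffAt ℝ n ((fun x => ContinuousLinearMap.inCoordinates E (TangentSpace I) F
      (Bundle.Trivial N F) p x p x (A x)) ∘ (extChartAt I p).symm) (extChartAt I p p) := by
    rw [← contMDiffAt_iff_contDiffAt]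
    refine ContMDiffAt.comp_of_eq (I' := I) ((contMDiffAt_hom_bundle _).1 hA).2 ?_
      (extChartAt_to_inv p)
    exact (contMDiffOn_extChartAt_symm p).contMDiffAt (extChartAt_target_mem_nhds p)
  refine hcoord.congr_of_eventuallyEq ?_
  filter_upwards [extChartAt_target_mem_nhds (I := I) p] with y hy
  have hs : (extChartAt I p).symm y ∈ (chartAt H p).source := by
    rw [← extChartAt_source I]
    exact (extChartAt I p).map_target hy
  have htangent := TangentBundle.symmL_trivializationAt (I := I) hs
  rw [(extChartAt I p).right_inv hy, I.range_eq_univ, mfderivWithin_univ] at htangent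
  have htrivial (w : F) : (trivializationAt F (Bundle.Trivial N F) p).continuousLinearMapAt ℝ
      ((extChartAt I p).symm y) w = w := by simp
  ext v
  simp only [Function.comp_apply, ContinuousLinearMap.inCoordinates, htangent]
  exact (htrivial _).symm

theorem pullbackForm_eventuallyEq [IsManifold I 1 N]
    (A : ∀ x : N, TangentSpace I x →L[ℝ] F) {Φ : E' → N} {y₀ : E'}
    (hΦ : ContMDiffAt 𝓘(ℝ, E') I 1 Φ y₀) :
    pullbackForm I A Φ =ᶠ[𝓝 y₀] fun y =>
      (pullbackForm I A (extChartAt I (Φ y₀)).symm (extChartAt I (Φ y₀) (Φ y))).comp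
        (fderiv ℝ (fun y => extChartAt I (Φ y₀) (Φ y)) y) := by
  have hsrc : ∀ᶠ y in 𝓝 y₀, Φ y ∈ (extChartAt I (Φ y₀)).source :=
    hΦ.continuousAt (extChartAt_source_mem_nhds _)
  filter_upwards [hsrc.eventually_nhds, (contMDiffAt_iff_contMDiffAt_nhds (by simp)).1 hΦ]
    with y hy hΦy
  have hfactor : Φ =ᶠ[𝓝 y] (extChartAt I (Φ y₀)).symm ∘ fun y => extChartAt I (Φ y₀) (Φ y) := by
    filter_upwards [hy] with z hz
    exact ((extChartAt I (Φ y₀)).left_inv hz).symm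
  have hsrc_y := hy.self_of_nhds
  rw [pullbackForm_congr A hfactor, pullbackForm_comp A
    (φ := fun z => extChartAt I (Φ y₀) (Φ z))
    (mdifferentiableAt_extChartAt_symm ((extChartAt I (Φ y₀)).map_source hsrc_y))]
  exact ((mdifferentiableAt_extChartAt (by rwa [← extChartAt_source I])).comp y
    (hΦy.mdifferentiableAt one_ne_zero)).differentiableAt

variable [IsManifold I 2 N] {A : ∀ x : N, TangentSpace I x →L[ℝ] ℂ} {Φ : E' → N} {y : E'}

theorem differentiableAt_pullbackForm (hΦ : ContMDiffAt 𝓘(ℝ, E') I 2 Φ y)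
    (hA : DifferentiableAt ℝ (pullbackForm I A (extChartAt I (Φ y)).symm)
      (extChartAt I (Φ y) (Φ y))) :
    DifferentiableAt ℝ (pullbackForm I A Φ) y :=
  (differentiableAt_pullback (φ := fun z => extChartAt I (Φ y) (Φ z)) hA
    (contDiffAt_extChartAt_comp hΦ)).congr_of_eventuallyEq
    (pullbackForm_eventuallyEq A (hΦ.of_le one_le_two))

theorem extDerivLinear_pullbackForm (hΦ : ContMDiffAt 𝓘(ℝ, E') I 2 Φ y)
    (hA : DifferentiableAt ℝ (pullbackForm I A (extChartAt I (Φ y)).symm)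
      (extChartAt I (Φ y) (Φ y))) (u v : E') :
    extDerivLinear (pullbackForm I A Φ) y u v =
      extDerivOneForm I A (Φ y) (mfderiv 𝓘(ℝ, E') I Φ y u) (mfderiv 𝓘(ℝ, E') I Φ y v) := by
  have hmf := mfderiv_eq_fderiv_extChartAt_comp (hΦ.mdifferentiableAt two_ne_zero)
  rw [extDerivLinear_congr (pullbackForm_eventuallyEq A (hΦ.of_le one_le_two)),
    extDerivLinear_pullback (φ := fun z => extChartAt I (Φ y) (Φ z)) hA
      (contDiffAt_extChartAt_comp hΦ) minSmoothness_of_isRCLikeNormedField.le, ← hmf]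
  rfl

theorem extDerivLinear_pullbackForm_comp_extChartAt_symm {H' : Type*} [TopologicalSpace H']
    {I' : ModelWithCorners ℝ E' H'} [I'.Boundaryless] {N' : Type*} [TopologicalSpace N']
    [ChartedSpace H' N'] [IsManifold I' 2 N'] {f : N' → N} {p : N'} (hf : ContMDiffAt I' I 2 f p)
    (hA : DifferentiableAt ℝ (pullbackForm I A (extChartAt I (f p)).symm)
      (extChartAt I (f p) (f p))) (u v : TangentSpace I' p) :
    extDerivLinear (pullbackForm I A (f ∘ (extChartAt I' p).symm)) (extChartAt I' p p) u v =
      extDerivOneForm I A (f p) (mfderiv I' I f p u) (mfderiv I' I f p v) := by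
  have : IsManifold I' 1 N' := .of_le one_le_two
  have hchart : ContMDiffAt 𝓘(ℝ, E') I' 2 (extChartAt I' p).symm (extChartAt I' p p) :=
    contMDiffAt_extChartAt_symm (mem_extChartAt_target p)
  have hdf (w : E') : (mfderiv 𝓘(ℝ, E') I (f ∘ (extChartAt I' p).symm) (extChartAt I' p p) w : E) =
      mfderiv I' I f p w :=
    (mfderiv_comp_apply_of_eq (extChartAt I' p p) (hf.mdifferentiableAt two_ne_zero)
      (hchart.mdifferentiableAt two_ne_zero) (extChartAt_to_inv p) w).trans
      (congrArg (mfderiv I' I f p) (DFunLike.congr_fun (mfderiv_extChartAt_symm_self p) w))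
  have hbase : (f ∘ (extChartAt I' p).symm) (extChartAt I' p p) = f p :=
    congrArg f (extChartAt_to_inv p)
  refine (extDerivLinear_pullbackForm (hf.comp_of_eq hchart (extChartAt_to_inv p))
    (by rwa [hbase]) u v).trans ?_
  exact (congrArg₂ (extDerivOneForm I A _) (hdf u) (hdf v)).trans
    (congrArg (fun q => extDerivOneForm I A q (mfderiv I' I f p u : E) (mfderiv I' I f p v : E))
      hbase)

end OneForms

section VectorFields

open VectorField

variable {E : Type*} [NormedAddCommGroup E] [NormedSpace ℝ E]
  {H : Type*} [TopologicalSpace H] {I : ModelWithCorners ℝ E H} [I.Boundaryless]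
  {N : Type*} [TopologicalSpace N] [ChartedSpace H N]
  {E' : Type*} [NormedAddCommGroup E'] [NormedSpace ℝ E']
  {H' : Type*} [TopologicalSpace H'] {I' : ModelWithCorners ℝ E' H'}
  {N' : Type*} [TopologicalSpace N'] [ChartedSpace H' N']
  {V W : ∀ x : N, TangentSpace I x} {V' W' : ∀ x : N', TangentSpace I' x} {p : N}

theorem extDerivOneForm_apply_vectorField [IsManifold I 1 N]
    {A : ∀ x : N, TangentSpace I x →L[ℝ] ℂ}
    (hA : DifferentiableAt ℝ (pullbackForm I A (extChartAt I p).symm) (extChartAt I p p))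
    (hV : DifferentiableAt ℝ (vfChart I V p) (extChartAt I p p))
    (hW : DifferentiableAt ℝ (vfChart I W p) (extChartAt I p p))
    (hAV : MDifferentiableAt I 𝓘(ℝ, ℂ) (fun x => A x (V x)) p)
    (hAW : MDifferentiableAt I 𝓘(ℝ, ℂ) (fun x => A x (W x)) p) :
    extDerivOneForm I A p (V p) (W p) = mvfderiv I (fun x => A x (W x)) p (V p) -
      mvfderiv I (fun x => A x (V x)) p (W p) - A p (mlieBracket I V W p) := by
  have hderiv (W : ∀ x : N, TangentSpace I x)
      (hAW : MDifferentiableAt I 𝓘(ℝ, ℂ) (fun x => A x (W x)) p) (v : E) :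
      fderiv ℝ (fun y => pullbackForm I A (extChartAt I p).symm y (vfChart I W p y))
        (extChartAt I p p) v = mvfderiv I (fun x => A x (W x)) p v := by
    have hev : (fun y => pullbackForm I A (extChartAt I p).symm y (vfChart I W p y))
        =ᶠ[𝓝 (extChartAt I p p)] writtenInExtChartAt I 𝓘(ℝ, ℂ) p fun x => A x (W x) := by
      filter_upwards [extChartAt_target_mem_nhds p] with y hy
      exact pullbackForm_extChartAt_symm_vfChart A W hy
    rw [hev.fderiv_eq]
    exact (DFunLike.congr_fun (mfderiv_eq_fderiv_writtenInExtChartAt hAW) v).symm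
  have h := extDerivLinear_apply_vectorField hA hV hW
  rw [hderiv W hAW, hderiv V hAV, ← mlieBracket_eq_lieBracket_vfChart,
    pullbackForm_extChartAt_symm_self, vfChart_self, vfChart_self] at h
  exact (extDerivOneForm_eq_extDerivLinear A p (V p) (W p)).trans h

variable {f : N → N'}

theorem fderiv_writtenInExtChartAt_vfChart [IsManifold I 1 N] [IsManifold I' 1 N'] {y : E}
    (hy : y ∈ (extChartAt I p).target)
    (hfy : f ((extChartAt I p).symm y) ∈ (extChartAt I' (f p)).source)
    (hf : MDifferentiableAt I I' f ((extChartAt I p).symm y))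
    (h : mfderiv I I' f _ (V ((extChartAt I p).symm y)) = V' (f ((extChartAt I p).symm y))) :
    fderiv ℝ (writtenInExtChartAt I I' p f) y (vfChart I V p y) =
      vfChart I' V' (f p) (writtenInExtChartAt I I' p f y) := by
  have hchart : MDifferentiableAt I' 𝓘(ℝ, E') (extChartAt I' (f p))
      (f ((extChartAt I p).symm y)) :=
    mdifferentiableAt_extChartAt (by rwa [← extChartAt_source I'])
  have hcomp := mfderiv_comp y (hchart.comp _ hf) (mdifferentiableAt_extChartAt_symm hy)
  rw [mfderiv_eq_fderiv, mfderiv_comp _ hchart hf] at hcomp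
  rw [writtenInExtChartAt, Function.comp_apply, Function.comp_apply, vfChart_extChartAt V' hfy,
    ← h, ← Function.comp_assoc]
  exact (DFunLike.congr_fun hcomp _).trans <|
    congrArg (fun w => mfderiv I' 𝓘(ℝ, E') (extChartAt I' (f p)) _ (mfderiv I I' f _ w))
      (mfderiv_extChartAt_symm_mfderiv_extChartAt hy _)

theorem mfderiv_mlieBracket_of_related [I'.Boundaryless] [IsManifold I 2 N] [IsManifold I' 2 N']
    (hf : ContMDiff I I' 2 f)
    (hV : DifferentiableAt ℝ (vfChart I V p) (extChartAt I p p))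
    (hW : DifferentiableAt ℝ (vfChart I W p) (extChartAt I p p))
    (hV' : DifferentiableAt ℝ (vfChart I' V' (f p)) (extChartAt I' (f p) (f p)))
    (hW' : DifferentiableAt ℝ (vfChart I' W' (f p)) (extChartAt I' (f p) (f p)))
    (relV : ∀ q, mfderiv I I' f q (V q) = V' (f q))
    (relW : ∀ q, mfderiv I I' f q (W q) = W' (f q)) :
    mfderiv I I' f p (mlieBracket I V W p) = mlieBracket I' V' W' (f p) := by
  have hdiff (q : N) : MDifferentiableAt I I' f q := (hf q).mdifferentiableAt two_ne_zero
  have hg : ContDiffAt ℝ 2 (writtenInExtChartAt I I' p f) (extChartAt I p p) := by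
    have h := (contMDiffAt_iff.1 (hf p)).2
    rwa [I.range_eq_univ, contDiffWithinAt_univ] at h
  have hgp : writtenInExtChartAt I I' p f (extChartAt I p p) = extChartAt I' (f p) (f p) := by
    simp [writtenInExtChartAt]
  have hsrc : ∀ᶠ y in 𝓝 (extChartAt I p p),
      f ((extChartAt I p).symm y) ∈ (extChartAt I' (f p)).source := by
    refine ((hdiff p).continuousAt.comp_of_eq (continuousAt_extChartAt_symm p)
      (extChartAt_to_inv p)).preimage_mem_nhds ?_
    simpa only [Function.comp_apply, extChartAt_to_inv] using extChartAt_source_mem_nhds (f p)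
  have rel {V : ∀ x : N, TangentSpace I x} {V' : ∀ x : N', TangentSpace I' x}
      (h : ∀ q, mfderiv I I' f q (V q) = V' (f q)) :
      (fun y => fderiv ℝ (writtenInExtChartAt I I' p f) y (vfChart I V p y))
        =ᶠ[𝓝 (extChartAt I p p)]
          fun y => vfChart I' V' (f p) (writtenInExtChartAt I I' p f y) := by
    filter_upwards [hsrc, extChartAt_target_mem_nhds p] with y hfy hy
    exact fderiv_writtenInExtChartAt_vfChart hy hfy (hdiff _) (h _)
  have h := fderiv_lieBracket_of_related hg minSmoothness_of_isRCLikeNormedField.le hV hW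
    (hgp ▸ hV') (hgp ▸ hW') (rel relV) (rel relW)
  rw [hgp, ← mfderiv_eq_fderiv_writtenInExtChartAt (hdiff p), ← mlieBracket_eq_lieBracket_vfChart,
    ← mlieBracket_eq_lieBracket_vfChart] at h
  exact h

end VectorFields

section OrbitField

open Filter VectorField

variable {EG : Type*} [NormedAddCommGroup EG] [NormedSpace ℝ EG]
  {HG : Type*} [TopologicalSpace HG] {IG : ModelWithCorners ℝ EG HG}
  {G : Type*} [TopologicalSpace G] [ChartedSpace HG G] [Group G]
  {E : Type*} [NormedAddCommGroup E] [NormedSpace ℝ E]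
  {H : Type*} [TopologicalSpace H] {I : ModelWithCorners ℝ E H}
  {N : Type*} [TopologicalSpace N] [ChartedSpace H N]

variable (I) in
/-- The vector field on `N` generated by `ξ ∈ Lie(G)` and a local right action `a : N → G → N`,
that is, a map with `a x 1 = x` which is smooth near `N × {1}`; compatibility with the product of
`G` is not assumed. -/
noncomputable def orbitField (a : N → G → N) (ξ : GroupLieAlgebra IG G) (x : N) :
    TangentSpace I x :=
  (mfderiv IG I (a x) 1 ξ : E)

variable (IG I) in
/-- A local right action `a : N → G → N`, read in the preferred charts at `1 : G` and `p : N`. -/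
noncomputable def actionChart (a : N → G → N) (p : N) (q : EG × E) : E :=
  extChartAt I p (a ((extChartAt I p).symm q.2) ((extChartAt IG (1 : G)).symm q.1))

theorem actionChart_extChartAt {a : N → G → N} {p x : N} {g : G}
    (hx : x ∈ (extChartAt I p).source) (hg : g ∈ (extChartAt IG (1 : G)).source) :
    actionChart IG I a p (extChartAt IG (1 : G) g, extChartAt I p x) =
      extChartAt I p (a x g) := by
  rw [actionChart, (extChartAt I p).left_inv hx, (extChartAt IG (1 : G)).left_inv hg]

theorem eventually_actionChart_one {a : N → G → N} {p : N} [I.Boundaryless]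
    (one : ∀ x, a x 1 = x) :
    ∀ᶠ y in 𝓝 (extChartAt I p p), actionChart IG I a p (extChartAt IG (1 : G) 1, y) = y := by
  filter_upwards [extChartAt_target_mem_nhds p] with y hy
  rw [actionChart, extChartAt_to_inv, one, (extChartAt I p).right_inv hy]

section Tendsto

variable {X : Type*} {l : Filter X} {f : X → N} {γ : X → G} {a : N → G → N} {p : N}

theorem tendsto_localAction (one : a p 1 = p)
    (ha : ContinuousAt (fun q : N × G => a q.1 q.2) (p, 1)) (hf : Tendsto f l (𝓝 p))
    (hγ : Tendsto γ l (𝓝 1)) : Tendsto (fun q => a (f q) (γ q)) l (𝓝 p) := by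
  have h : Tendsto (fun q : N × G => a q.1 q.2) (𝓝 (p, 1)) (𝓝 p) := by
    simpa only [ContinuousAt, one] using ha
  exact h.comp (hf.prodMk_nhds hγ)

variable (IG I) in
theorem eventually_extChartAt_localAction (hf : Tendsto f l (𝓝 p)) (hγ : Tendsto γ l (𝓝 1)) :
    ∀ᶠ q in l, extChartAt I p (a (f q) (γ q)) =
      actionChart IG I a p (extChartAt IG (1 : G) (γ q), extChartAt I p (f q)) := by
  filter_upwards [hf (extChartAt_source_mem_nhds (I := I) p),
    hγ (extChartAt_source_mem_nhds (I := IG) (1 : G))] with q hx hg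
  exact (actionChart_extChartAt hx hg).symm

variable (IG I) in
theorem eventually_extChartAt_localAction_iterate (one : a p 1 = p)
    (ha : ContinuousAt (fun q : N × G => a q.1 q.2) (p, 1)) {γ₁ γ₂ γ₃ γ₄ : X → G}
    (h₁ : Tendsto γ₁ l (𝓝 1)) (h₂ : Tendsto γ₂ l (𝓝 1)) (h₃ : Tendsto γ₃ l (𝓝 1))
    (h₄ : Tendsto γ₄ l (𝓝 1)) :
    ∀ᶠ q in l, extChartAt I p (a (a (a (a p (γ₁ q)) (γ₂ q)) (γ₃ q)) (γ₄ q)) =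
      actionChart IG I a p (extChartAt IG (1 : G) (γ₄ q),
        actionChart IG I a p (extChartAt IG (1 : G) (γ₃ q),
          actionChart IG I a p (extChartAt IG (1 : G) (γ₂ q),
            actionChart IG I a p (extChartAt IG (1 : G) (γ₁ q), extChartAt I p p)))) := by
  have t₀ : Tendsto (fun _ : X => p) l (𝓝 p) := tendsto_const_nhds
  have t₁ := tendsto_localAction one ha t₀ h₁
  have t₂ := tendsto_localAction one ha t₁ h₂
  have t₃ := tendsto_localAction one ha t₂ h₃
  filter_upwards [eventually_extChartAt_localAction IG I (a := a) t₀ h₁,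
    eventually_extChartAt_localAction IG I (a := a) t₁ h₂,
    eventually_extChartAt_localAction IG I (a := a) t₂ h₃,
    eventually_extChartAt_localAction IG I (a := a) t₃ h₄] with q e₁ e₂ e₃ e₄
  rw [e₄, e₃, e₂, e₁]

end Tendsto

variable {n : ℕ∞ω} {a : N → G → N} {p : N}

theorem mdifferentiableAt_orbitMap (ha : ContMDiffAt (I.prod IG) I n (fun q : N × G => a q.1 q.2)
    (p, 1)) (hn : n ≠ 0) : MDifferentiableAt IG I (a p) 1 :=
  (ha.mdifferentiableAt hn).comp (1 : G) (mdifferentiableAt_const.prodMk mdifferentiableAt_id)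

variable [IG.Boundaryless] [I.Boundaryless]

theorem contDiffAt_actionChart [IsManifold IG n G] [IsManifold I n N] (one : a p 1 = p)
    (ha : ContMDiffAt (I.prod IG) I n (fun q : N × G => a q.1 q.2) (p, 1)) :
    ContDiffAt ℝ n (actionChart IG I a p) (extChartAt IG (1 : G) 1, extChartAt I p p) := by
  have hfst : ContMDiffAt 𝓘(ℝ, EG × E) IG n (fun q => (extChartAt IG (1 : G)).symm q.1)
      (extChartAt IG (1 : G) 1, extChartAt I p p) :=
    ContMDiffAt.comp _ ((contMDiffOn_extChartAt_symm (1 : G)).contMDiffAt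
      (extChartAt_target_mem_nhds (1 : G))) contDiffAt_fst.contMDiffAt
  have hsnd : ContMDiffAt 𝓘(ℝ, EG × E) I n (fun q => (extChartAt I p).symm q.2)
      (extChartAt IG (1 : G) 1, extChartAt I p p) :=
    ContMDiffAt.comp _ ((contMDiffOn_extChartAt_symm p).contMDiffAt
      (extChartAt_target_mem_nhds p)) contDiffAt_snd.contMDiffAt
  have hcomp := ha.comp_of_eq (hsnd.prodMk hfst) (by simp only [extChartAt_to_inv])
  have hread := contDiffAt_extChartAt_comp hcomp
  simp only [Function.comp_apply, extChartAt_to_inv, one] at hread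
  exact hread

theorem vfChart_orbitField [IsManifold IG 1 G] [IsManifold I 1 N] (one : ∀ x, a x 1 = x)
    (ha : ∀ x, ContMDiffAt (I.prod IG) I 1 (fun q : N × G => a q.1 q.2) (x, 1)) (p : N)
    (ξ : GroupLieAlgebra IG G) :
    vfChart I (orbitField I a ξ) p =ᶠ[𝓝 (extChartAt I p p)]
      generator ℝ (actionChart IG I a p) (extChartAt IG (1 : G) 1) ξ := by
  have hS : ∀ᶠ y in 𝓝 (extChartAt I p p),
      DifferentiableAt ℝ (actionChart IG I a p) (extChartAt IG (1 : G) 1, y) :=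
    (Continuous.prodMk_right _).continuousAt.eventually
      (((contDiffAt_actionChart (one p) (ha p)).eventually (by simp)).mono fun _ h =>
        h.differentiableAt one_ne_zero)
  filter_upwards [hS, extChartAt_target_mem_nhds p] with y hSy hy
  set x := (extChartAt I p).symm y
  have horbit := mdifferentiableAt_orbitMap (ha x) one_ne_zero
  have hchart : MDifferentiableAt I 𝓘(ℝ, E) (extChartAt I p) x :=
    mdifferentiableAt_extChartAt (extChartAt_source I p ▸ (extChartAt I p).map_target hy)
  have hline : HasFDerivAt (fun h => actionChart IG I a p (h, y)) _ (extChartAt IG (1 : G) 1) :=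
    HasFDerivAt.comp (f := fun h => (h, y)) _ hSy.hasFDerivAt (hasFDerivAt_prodMk_left _ y)
  have hchain := mfderiv_comp_apply_of_eq _ hchart horbit (one x) ξ
  have hread := mfderiv_eq_fderiv_writtenInExtChartAt (hchart.comp_of_eq _ horbit (one x))
  exact hchain.symm.trans <| (DFunLike.congr_fun hread ξ).trans (DFunLike.congr_fun hline.fderiv ξ)

theorem contDiffAt_vfChart_orbitField {m : ℕ∞ω} (hmn : m + 1 ≤ n) [IsManifold IG 1 G]
    [IsManifold I 1 N] [IsManifold IG n G] [IsManifold I n N] (one : ∀ x, a x 1 = x)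
    (ha : ∀ x, ContMDiffAt (I.prod IG) I n (fun q : N × G => a q.1 q.2) (x, 1)) (p : N)
    (ξ : GroupLieAlgebra IG G) :
    ContDiffAt ℝ m (vfChart I (orbitField I a ξ) p) (extChartAt I p p) := by
  refine ContDiffAt.congr_of_eventuallyEq ?_
    (vfChart_orbitField one (fun x => (ha x).of_le (le_add_self.trans hmn)) p ξ)
  have hline : ContDiffAt ℝ m (fun y => (extChartAt IG (1 : G) 1, y)) (extChartAt I p p) :=
    contDiffAt_const.prodMk contDiffAt_id
  exact (((contDiffAt_actionChart (one p) (ha p)).fderiv_right hmn).comp _ hline).clm_apply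
    contDiffAt_const

variable [IsManifold IG 2 G] [IsManifold I 2 N] (one : ∀ x, a x 1 = x)
  (ha : ∀ x, ContMDiffAt (I.prod IG) I 2 (fun q : N × G => a q.1 q.2) (x, 1))
include one ha

theorem differentiableAt_vfChart_orbitField (p : N) (ξ : GroupLieAlgebra IG G) :
    DifferentiableAt ℝ (vfChart I (orbitField I a ξ) p) (extChartAt I p p) :=
  (contDiffAt_vfChart_orbitField (m := 1) (by norm_num) one ha p ξ).differentiableAt one_ne_zero

theorem hasMixedDeriv_commutator (p : N) {α β : ℝ → G} {ξ η : GroupLieAlgebra IG G}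
    (hα₀ : α 0 = 1) (hβ₀ : β 0 = 1) (hαc : ContinuousAt α 0) (hβc : ContinuousAt β 0)
    (hα : HasDerivAt (fun t => extChartAt IG (1 : G) (α t)) (ξ : EG) 0)
    (hβ : HasDerivAt (fun t => extChartAt IG (1 : G) (β t)) (η : EG) 0) :
    HasMixedDeriv I (fun t s => a (a (a (a p (α t)) (β s)) (α (-t))) (β (-s))) p
      (mlieBracket I (orbitField I a ξ) (orbitField I a η) p) := by
  obtain ⟨w, hw, hw'⟩ := hasDerivAt_commutator (contDiffAt_actionChart (one p) (ha p))
    minSmoothness_of_isRCLikeNormedField.le (eventually_actionChart_one one) hα (by rw [hα₀])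
    hβ (by rw [hβ₀])
  have tendsto_neg {γ : ℝ → G} (hγ : Tendsto γ (𝓝 0) (𝓝 1)) :
      Tendsto (fun t => γ (-t)) (𝓝 0) (𝓝 1) :=
    hγ.comp (by simpa only [neg_zero] using (continuous_neg (G := ℝ)).tendsto 0)
  rw [ContinuousAt, hα₀] at hαc
  rw [ContinuousAt, hβ₀] at hβc
  have hfst : Tendsto (Prod.fst : ℝ × ℝ → ℝ) (𝓝 (0, 0)) (𝓝 0) := continuousAt_fst
  have hsnd : Tendsto (Prod.snd : ℝ × ℝ → ℝ) (𝓝 (0, 0)) (𝓝 0) := continuousAt_snd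
  have hread := eventually_extChartAt_localAction_iterate IG I (one p) (ha p).continuousAt
    (hαc.comp hsnd) (hβc.comp hfst) ((tendsto_neg hαc).comp hsnd) ((tendsto_neg hβc).comp hfst)
  have ha₁ (x : N) := (ha x).of_le one_le_two
  have hbracket := ((vfChart_orbitField one ha₁ p ξ).lieBracket_vectorField_eq
    (vfChart_orbitField one ha₁ p η)).symm.trans
      (mlieBracket_eq_lieBracket_vfChart (orbitField I a ξ) (orbitField I a η) p).symm
  refine ⟨w, ?_, hw'.congr_deriv hbracket⟩
  filter_upwards [hw, hread.curry_nhds] with s hs hreads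
  exact hs.congr_of_eventuallyEq hreads

end OrbitField

section LieGroup

open VectorField

variable {EG : Type*} [NormedAddCommGroup EG] [NormedSpace ℝ EG]
  {HG : Type*} [TopologicalSpace HG] {IG : ModelWithCorners ℝ EG HG}
  {G : Type*} [TopologicalSpace G] [ChartedSpace HG G] [Group G]
  {E : Type*} [NormedAddCommGroup E] [NormedSpace ℝ E]
  {H : Type*} [TopologicalSpace H] {I : ModelWithCorners ℝ E H}
  {N : Type*} [TopologicalSpace N] [ChartedSpace H N]

theorem mulInvariantVectorField_one (ξ : GroupLieAlgebra IG G) :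
    mulInvariantVectorField ξ (1 : G) = ξ := by
  have h : (fun g : G => 1 * g) = id := funext one_mul
  exact (DFunLike.congr_fun (mfderiv_congr (I := IG) (I' := IG) (x := 1) h) ξ).trans
    (DFunLike.congr_fun mfderiv_id ξ)

section RightAction

variable [LieGroup IG ∞ G] [MulAction Gᵐᵒᵖ N]

theorem mfderiv_orbit_mulInvariantVectorField {x : N}
    (hx : ∀ g : G, MDifferentiableAt IG I (fun g : G => x <• g) g) (ξ : GroupLieAlgebra IG G)
    (g : G) :
    mfderiv IG I (fun g : G => x <• g) g (mulInvariantVectorField ξ g) =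
      fundField I ξ (x <• g) := by
  have hmul : MDifferentiableAt IG IG (fun h : G => g * h) 1 :=
    (contMDiff_mul_left (n := ∞)).mdifferentiable (by simp) 1
  have h := mfderiv_comp_apply_of_eq (1 : G) (hx g) hmul (mul_one g) ξ
  have hcomp : (fun g : G => x <• g) ∘ (fun h : G => g * h) = fun h : G => (x <• g) <• h := by
    ext h
    simp only [Function.comp_apply, MulOpposite.op_mul, mul_smul]
  exact h.symm.trans (DFunLike.congr_fun (mfderiv_congr (I := IG) (I' := I) (x := 1) hcomp) ξ)

theorem mlieBracket_fundField [IG.Boundaryless] [I.Boundaryless] [IsManifold I 2 N]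
    (hact : ContMDiff (I.prod IG) I 2 (fun q : N × G => q.1 <• q.2)) (ξ η : GroupLieAlgebra IG G)
    (x : N) :
    mlieBracket I (fundField I ξ) (fundField I η) x = fundField I ⁅ξ, η⁆ x := by
  have horbit : ContMDiff IG I 2 (fun g : G => x <• g) :=
    hact.comp (contMDiff_const.prodMk contMDiff_id)
  have hinvariant (ξ : GroupLieAlgebra IG G) : DifferentiableAt ℝ
      (vfChart IG (fun g : G => mulInvariantVectorField ξ g) 1) (extChartAt IG (1 : G) 1) :=
    differentiableAt_vfChart_orbitField (a := fun g h : G => g * h) mul_one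
      (fun g => (contMDiff_mul IG ∞).of_le (by norm_cast) (g, 1)) 1 ξ
  have hfund (ξ : GroupLieAlgebra IG G) (y : N) :
      DifferentiableAt ℝ (vfChart I (fundField I ξ) y) (extChartAt I y y) :=
    differentiableAt_vfChart_orbitField (a := fun (y : N) (g : G) => y <• g)
      (fun y => by simp only [MulOpposite.op_one, one_smul]) (fun y => hact (y, 1)) y ξ
  have rel := mfderiv_orbit_mulInvariantVectorField fun g =>
    (horbit g).mdifferentiableAt two_ne_zero
  have h := mfderiv_mlieBracket_of_related horbit (p := 1) (hinvariant ξ) (hinvariant η)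
    (hfund ξ _) (hfund η _) (rel ξ) (rel η)
  have one : x <• (1 : G) = x := by simp only [MulOpposite.op_one, one_smul]
  exact (congrArg (fun y => (mlieBracket I (fundField I ξ) (fundField I η) y : E)) one).symm.trans
    h.symm

end RightAction

section OneParameterSubgroup

variable [CompleteSpace EG] [IG.Boundaryless] [LieGroup IG ∞ G] [T2Space G]
  {F : Type*} [NormedAddCommGroup F] [NormedSpace ℝ F]

theorem expCurve_zero (ξ : GroupLieAlgebra IG G) : expCurve ξ 0 = 1 :=
  (Classical.choose_spec (exists_oneParameterSubgroup ξ)).1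

theorem hasMFDerivAt_expCurve (ξ : GroupLieAlgebra IG G) (t : ℝ) :
    HasMFDerivAt 𝓘(ℝ, ℝ) IG (expCurve ξ) t
      ((1 : ℝ →L[ℝ] ℝ).smulRight (mulInvariantVectorField ξ (expCurve ξ t))) :=
  (Classical.choose_spec (exists_oneParameterSubgroup ξ)).2 t

theorem mfderiv_expCurve_zero (ξ : GroupLieAlgebra IG G) :
    (mfderiv 𝓘(ℝ, ℝ) IG (expCurve ξ) 0 (1 : ℝ) : EG) = ξ := by
  have hfield : (mulInvariantVectorField ξ (expCurve ξ 0) : EG) = ξ :=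
    (congrArg (fun g => (mulInvariantVectorField ξ g : EG)) (expCurve_zero ξ)).trans
      (mulInvariantVectorField_one ξ)
  exact ((DFunLike.congr_fun (hasMFDerivAt_expCurve ξ 0).mfderiv (1 : ℝ)).trans
    (one_smul ℝ _)).trans hfield

theorem hasDerivAt_comp_expCurve (ξ : GroupLieAlgebra IG G) {φ : G → F}
    (hφ : MDifferentiableAt IG 𝓘(ℝ, F) φ 1) :
    HasDerivAt (fun t => φ (expCurve ξ t)) (mfderiv IG 𝓘(ℝ, F) φ 1 ξ : F) 0 := by
  have hexp := (hasMFDerivAt_expCurve ξ 0).mdifferentiableAt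
  have hchain := mfderiv_comp_apply_of_eq (0 : ℝ) hφ hexp (expCurve_zero ξ) (1 : ℝ)
  rw [mfderiv_eq_fderiv] at hchain
  have hderiv := (hφ.comp_of_eq _ hexp (expCurve_zero ξ)).differentiableAt.hasFDerivAt.hasDerivAt
  refine hderiv.congr_deriv (hchain.trans ?_)
  exact congrArg (fun v => (mfderiv IG 𝓘(ℝ, F) φ 1 v : F)) (mfderiv_expCurve_zero ξ)

theorem hasDerivAt_extChartAt_expCurve (ξ : GroupLieAlgebra IG G) :
    HasDerivAt (fun t => extChartAt IG (1 : G) (expCurve ξ t)) (ξ : EG) 0 := by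
  have : IsManifold IG 1 G := inferInstance
  have hchart : MDifferentiableAt IG 𝓘(ℝ, EG) (extChartAt IG (1 : G)) 1 :=
    mdifferentiableAt_extChartAt (mem_chart_source HG _)
  exact (hasDerivAt_comp_expCurve ξ hchart).congr_deriv
    (mfderiv_extChartAt_self_apply (1 : G) ξ)

theorem lieAct_eq_mvfderiv [MulAction Gᵐᵒᵖ N] {f : N → ℂ} {x : N}
    (hx : MDifferentiableAt IG I (fun g : G => x <• g) 1)
    (hf : MDifferentiableAt I 𝓘(ℝ, ℂ) f x) (ξ : GroupLieAlgebra IG G) :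
    lieAct ξ f x = mvfderiv I f x (fundField I ξ x) := by
  have one : x <• (1 : G) = x := by simp only [MulOpposite.op_one, one_smul]
  exact (hasDerivAt_comp_expCurve ξ (hf.comp_of_eq _ hx one)).deriv.trans
    (mfderiv_comp_apply_of_eq _ hf hx one ξ)

end OneParameterSubgroup

end LieGroup

section Smoothness

variable {E : Type*} [NormedAddCommGroup E] [NormedSpace ℝ E]
  {H : Type*} [TopologicalSpace H] {I : ModelWithCorners ℝ E H}
  {N : Type*} [TopologicalSpace N] [ChartedSpace H N]

theorem HasMixedDeriv.unique {u : ℝ → ℝ → N} {p : N} {v v' : TangentSpace I p}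
    (h : HasMixedDeriv I u p v) (h' : HasMixedDeriv I u p v') : v = v' := by
  obtain ⟨w, hw, hv⟩ := h
  obtain ⟨w', hw', hv'⟩ := h'
  have hww' : w =ᶠ[𝓝 0] w' := by
    filter_upwards [hw, hw'] with s hs hs' using hs.unique hs'
  exact hv.unique (hv'.congr_of_eventuallyEq hww')

theorem contMDiffAt_of_eventuallyEq_extChartAt_symm {F : Type*} [NormedAddCommGroup F]
    [NormedSpace ℝ F] {n : ℕ∞ω} {f : N → F} {g : E → F} {p : N}
    (hg : ContDiffAt ℝ n g (extChartAt I p p))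
    (h : (fun y => f ((extChartAt I p).symm y)) =ᶠ[𝓝 (extChartAt I p p)] g) :
    ContMDiffAt I 𝓘(ℝ, F) n f p := by
  have hcomp : ContMDiffAt I 𝓘(ℝ, F) n (fun x => g (extChartAt I p x)) p :=
    ContDiffAt.comp_contMDiffAt hg contMDiffAt_extChartAt
  refine hcomp.congr_of_eventuallyEq ?_
  filter_upwards [(continuousAt_extChartAt (I := I) p).eventually h,
    extChartAt_source_mem_nhds (I := I) p] with x hx hsrc
  rw [← hx, (extChartAt I p).left_inv hsrc]

variable [I.Boundaryless] {V W : ∀ x : N, TangentSpace I x}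
  {A : ∀ x : N, TangentSpace I x →L[ℝ] ℂ} {m n : ℕ∞ω} {p : N}

theorem contMDiffAt_form_apply [IsManifold I 1 N]
    (hA : ContDiffAt ℝ n (pullbackForm I A (extChartAt I p).symm) (extChartAt I p p))
    (hV : ContDiffAt ℝ n (vfChart I V p) (extChartAt I p p)) :
    ContMDiffAt I 𝓘(ℝ, ℂ) n (fun q => A q (V q)) p := by
  refine contMDiffAt_of_eventuallyEq_extChartAt_symm (hA.clm_apply hV) ?_
  filter_upwards [extChartAt_target_mem_nhds (I := I) p] with y hy
  exact (pullbackForm_extChartAt_symm_vfChart A V hy).symm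

theorem contMDiffAt_mvfderiv_apply [IsManifold I 1 N] [IsManifold I n N]
    {f : N → ℂ} (hmn : m + 1 ≤ n) (hf : ContMDiffAt I 𝓘(ℝ, ℂ) n f p)
    (hV : ContDiffAt ℝ m (vfChart I V p) (extChartAt I p p)) :
    ContMDiffAt I 𝓘(ℝ, ℂ) m (fun q => mvfderiv I f q (V q)) p := by
  have hchart : ContDiffAt ℝ n (f ∘ (extChartAt I p).symm) (extChartAt I p p) :=
    (hf.comp_of_eq (contMDiffAt_extChartAt_symm (mem_extChartAt_target p))
      (extChartAt_to_inv p)).contDiffAt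
  refine contMDiffAt_of_eventuallyEq_extChartAt_symm
    ((hchart.fderiv_right hmn).clm_apply hV) ?_
  have hdiff : ∀ᶠ q in 𝓝 p, MDifferentiableAt I 𝓘(ℝ, ℂ) f q :=
    ((contMDiffAt_iff_contMDiffAt_nhds (by simp)).1
      (hf.of_le (le_add_self.trans hmn))).mono fun q hq => hq.mdifferentiableAt one_ne_zero
  filter_upwards [extChartAt_target_mem_nhds (I := I) p,
    (continuousAt_extChartAt_symm (I := I) p).eventually (by rwa [extChartAt_to_inv])]
    with y hy hfy
  have h := mfderiv_comp y hfy (mdifferentiableAt_extChartAt_symm hy)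
  rw [mfderiv_eq_fderiv] at h
  refine Eq.symm ((DFunLike.congr_fun h (vfChart I V p y)).trans ?_)
  exact congrArg (mfderiv I 𝓘(ℝ, ℂ) f ((extChartAt I p).symm y))
    (mfderiv_extChartAt_symm_mfderiv_extChartAt hy (V ((extChartAt I p).symm y)))

theorem contMDiffAt_extDerivOneForm_apply [IsManifold I 2 N]
    (hmn : m + 1 ≤ n)
    (hA : ∀ q, ContDiffAt ℝ n (pullbackForm I A (extChartAt I q).symm) (extChartAt I q q))
    (hV : ContDiffAt ℝ m (vfChart I V p) (extChartAt I p p))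
    (hW : ContDiffAt ℝ m (vfChart I W p) (extChartAt I p p)) :
    ContMDiffAt I 𝓘(ℝ, ℂ) m (fun q => extDerivOneForm I A q (V q) (W q)) p := by
  have hdA := (hA p).fderiv_right hmn
  have hn : n ≠ 0 := fun h => by simp [h] at hmn
  refine contMDiffAt_of_eventuallyEq_extChartAt_symm (((hdA.clm_apply hV).clm_apply hW).sub
    ((hdA.clm_apply hW).clm_apply hV)) ?_
  filter_upwards [extChartAt_target_mem_nhds (I := I) p] with y hy
  refine Eq.symm ((extDerivLinear_pullbackForm (A := A) (contMDiffAt_extChartAt_symm hy)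
    ((hA _).differentiableAt hn) (vfChart I V p y) (vfChart I W p y)).trans ?_)
  exact congrArg₂ (extDerivOneForm I A ((extChartAt I p).symm y))
    (mfderiv_extChartAt_symm_mfderiv_extChartAt hy (V ((extChartAt I p).symm y)))
    (mfderiv_extChartAt_symm_mfderiv_extChartAt hy (W ((extChartAt I p).symm y)))

end Smoothness

section ExpUnit

/-- The exponential map `ℂ → ℂˣ` of the Lie group `ℂˣ`. -/
noncomputable def expUnit (ζ : ℂ) : ℂˣ := Units.mk0 (Complex.exp ζ) (Complex.exp_ne_zero ζ)

theorem expUnit_zero : expUnit 0 = 1 := by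
  ext
  simp [expUnit]

theorem expUnit_add (ζ ζ' : ℂ) : expUnit (ζ + ζ') = expUnit ζ * expUnit ζ' := by
  ext
  simp [expUnit, Complex.exp_add]

theorem expUnit_log (z : ℂˣ) : expUnit (Complex.log z) = z := by
  ext
  simp [expUnit, Complex.exp_log]

theorem contMDiff_expUnit : ContMDiff 𝓘(ℝ, ℂ) 𝓘(ℝ, ℂ) ∞ expUnit :=
  .of_comp_isOpenEmbedding Units.isOpenEmbedding_val (Complex.contDiff_exp (𝕜 := ℝ)).contMDiff

theorem mfderiv_expUnit_zero (w : ℂ) : (mfderiv 𝓘(ℝ, ℂ) 𝓘(ℝ, ℂ) expUnit 0 w : ℂ) = w := by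
  have hexp : fderiv ℝ Complex.exp 0 w = w := by
    rw [((Complex.hasDerivAt_exp 0).hasFDerivAt.restrictScalars ℝ).fderiv]
    simp
  have h := mfderiv_eq_fderiv_extChartAt_comp
    ((contMDiff_expUnit 0).mdifferentiableAt (by simp))
  exact (DFunLike.congr_fun h w).trans hexp

theorem exists_contMDiffAt_expUnit_eq {E : Type*} [NormedAddCommGroup E] [NormedSpace ℝ E]
    {H : Type*} [TopologicalSpace H] {I : ModelWithCorners ℝ E H}
    {N : Type*} [TopologicalSpace N] [ChartedSpace H N] {n : ℕ∞ω} {τ : N → ℂˣ} {p : N}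
    (hτ : ContMDiffAt I 𝓘(ℝ, ℂ) n τ p) :
    ∃ ℓ : N → ℂ, ContMDiffAt I 𝓘(ℝ, ℂ) n ℓ p ∧ ∀ q, expUnit (ℓ q) = τ q := by
  refine ⟨fun q => Complex.log (τ p) + Complex.log ((τ q * (τ p)⁻¹ : ℂˣ) : ℂ), ?_, fun q => ?_⟩
  · have hratio : ContMDiffAt I 𝓘(ℝ, ℂ) n (fun q => ((τ q * (τ p)⁻¹ : ℂˣ) : ℂ)) p :=
      (Units.contMDiff_val (𝕜 := ℝ) _).comp p (hτ.mul contMDiffAt_const)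
    have hlog : ContDiffAt ℝ n (fun z => Complex.log (τ p : ℂ) + Complex.log z)
        ((τ p * (τ p)⁻¹ : ℂˣ) : ℂ) := by
      rw [mul_inv_cancel, Units.val_one]
      exact contDiffAt_const.add
        ((Complex.contDiffAt_log Complex.one_mem_slitPlane).restrict_scalars ℝ)
    exact ContDiffAt.comp_contMDiffAt (f := fun q => ((τ q * (τ p)⁻¹ : ℂˣ) : ℂ)) hlog hratio
  · rw [expUnit_add, expUnit_log, expUnit_log, mul_comm, inv_mul_cancel_right]

end ExpUnit

section PrincipalBundle

variable {EM : Type*} [NormedAddCommGroup EM] [NormedSpace ℝ EM]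
  {HM : Type*} [TopologicalSpace HM] {I : ModelWithCorners ℝ EM HM}
  {M : Type*} [TopologicalSpace M] [ChartedSpace HM M]
  {EP : Type*} [NormedAddCommGroup EP] [NormedSpace ℝ EP]
  {HP : Type*} [TopologicalSpace HP] {J : ModelWithCorners ℝ EP HP}
  {P : Type*} [TopologicalSpace P] [ChartedSpace HP P] [MulAction ℂˣ P]
  {E' : Type*} [NormedAddCommGroup E'] [NormedSpace ℝ E']
  {H' : Type*} [TopologicalSpace H'] {I' : ModelWithCorners ℝ E' H'}
  {N : Type*} [TopologicalSpace N] [ChartedSpace H' N]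
  {π : P → M}

theorem ConnectionForm.contDiffAt_pullbackForm_extChartAt_symm [J.Boundaryless]
    [IsManifold J ∞ P] (A : ConnectionForm J P) (p : P) :
    ContDiffAt ℝ ∞ (pullbackForm J (F := ℂ) A.form (extChartAt J p).symm) (extChartAt J p p) :=
  _root_.contDiffAt_pullbackForm_extChartAt_symm (A.contMDiff_form p)

theorem ConnectionForm.differentiableAt_pullbackForm_extChartAt_symm [J.Boundaryless]
    [IsManifold J ∞ P] (A : ConnectionForm J P) (p : P) :
    DifferentiableAt ℝ (pullbackForm J (F := ℂ) A.form (extChartAt J p).symm) (extChartAt J p p) :=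
  (A.contDiffAt_pullbackForm_extChartAt_symm p).differentiableAt (by simp)

namespace IsPrincipalCStarBundle

variable (hπ : IsPrincipalCStarBundle I J π)
include hπ

theorem contMDiff_const_smul (z : ℂˣ) : ContMDiff J J ∞ (fun p : P => z • p) :=
  hπ.contMDiff_smul.comp (contMDiff_const.prodMk contMDiff_id)

theorem contMDiff_smul_const (p : P) : ContMDiff 𝓘(ℝ, ℂ) J ∞ (fun z : ℂˣ => z • p) :=
  hπ.contMDiff_smul.comp (contMDiff_id.prodMk contMDiff_const)

theorem contMDiff_expUnit_smul :
    ContMDiff (𝓘(ℝ, ℂ).prod J) J ∞ (fun q : ℂ × P => expUnit q.1 • q.2) :=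
  hπ.contMDiff_smul.comp ((contMDiff_expUnit.comp contMDiff_fst).prodMk contMDiff_snd)

theorem exists_localTrivialization_section (x : M) : ∃ (U : Set M) (s : M → P) (τ : P → ℂˣ),
    IsOpen U ∧ x ∈ U ∧ ContMDiffOn I J ∞ s U ∧ ContMDiffOn J 𝓘(ℝ, ℂ) ∞ τ (π ⁻¹' U) ∧
    (∀ y ∈ U, π (s y) = y) ∧ ∀ p ∈ π ⁻¹' U, τ p • s (π p) = p := by
  obtain ⟨U, hU, hx, e, hsource, htarget, he, hesymm, hfst, hsnd⟩ := hπ.locally_trivial x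
  have hmem : ∀ y ∈ U, ((y, (1 : ℂˣ)) : M × ℂˣ) ∈ e.target := fun y hy => by
    simpa only [htarget, mem_prod, mem_univ, and_true] using hy
  have hs : ∀ y ∈ U, e.symm (y, 1) ∈ e.source := fun y hy => e.map_target (hmem y hy)
  have hproj : ∀ y ∈ U, π (e.symm (y, 1)) = y := fun y hy => by
    rw [← hfst _ (hs y hy), e.right_inv (hmem y hy)]
  refine ⟨U, fun y => e.symm (y, 1), fun p => (e p).2, hU, hx, ?_, ?_, hproj, fun p hp => ?_⟩
  · exact hesymm.comp (contMDiffOn_id.prodMk contMDiffOn_const) hmem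
  · exact hsource ▸ contMDiff_snd.comp_contMDiffOn he
  · have hp' : p ∈ e.source := by rwa [hsource]
    have hz : (e p).2 • e.symm (π p, 1) ∈ e.source := by
      rwa [hsource, mem_preimage, hπ.proj_smul, hproj _ hp]
    refine e.injOn hz hp' (Prod.ext ?_ ?_)
    · rw [hfst _ hz, hfst _ hp', hπ.proj_smul, hproj _ hp]
    · rw [hsnd _ (hs _ hp), e.right_inv (hmem _ hp), mul_one]

theorem exists_localSection (x : M) : ∃ s : M → P, ContMDiffAt I J ∞ s x ∧
    (∀ᶠ y in 𝓝 x, π (s y) = y) ∧ ∀ p, π p = x → ∃ ℓ : P → ℂ, ContMDiffAt J 𝓘(ℝ, ℂ) ∞ ℓ p ∧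
      ∀ᶠ q in 𝓝 p, expUnit (ℓ q) • s (π q) = q := by
  obtain ⟨U, s, τ, hU, hx, hs, hτ, hπs, hτs⟩ := hπ.exists_localTrivialization_section x
  refine ⟨s, hs.contMDiffAt (hU.mem_nhds hx),
    Filter.eventually_of_mem (hU.mem_nhds hx) hπs, ?_⟩
  rintro p rfl
  have hUp : π ⁻¹' U ∈ 𝓝 p := (hU.preimage hπ.contMDiff_proj.continuous).mem_nhds hx
  obtain ⟨ℓ, hℓ, hexp⟩ := exists_contMDiffAt_expUnit_eq (hτ.contMDiffAt hUp)
  refine ⟨ℓ, hℓ, Filter.eventually_of_mem hUp fun q hq => ?_⟩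
  rw [hexp, hτs q hq]

theorem surjective_proj : Function.Surjective π := fun x =>
  have ⟨s, _, hπs, _⟩ := hπ.exists_localSection x
  ⟨s x, hπs.self_of_nhds⟩

theorem exists_proj_eq_surjective_mfderiv (x : M) :
    ∃ p : P, π p = x ∧ Function.Surjective (mfderiv J I π p) := by
  obtain ⟨s, hs, hπs, -⟩ := hπ.exists_localSection x
  refine ⟨s x, hπs.self_of_nhds, fun v => ⟨mfderiv I J s x v, ?_⟩⟩
  have hcomp := mfderiv_comp x ((hπ.contMDiff_proj (s x)).mdifferentiableAt (by simp))
    (hs.mdifferentiableAt (by simp))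
  have hid := Filter.EventuallyEq.mfderiv_eq (I := I) (I' := I) (f₁ := π ∘ s) (f := id) hπs
  exact (DFunLike.congr_fun hcomp v).symm.trans
    ((DFunLike.congr_fun hid v).trans (DFunLike.congr_fun (mfderiv_id (I := I) (x := x)) v))

theorem mfderiv_expUnit_smul_const (p : P) (ζ w : ℂ) :
    mfderiv 𝓘(ℝ, ℂ) J (fun ζ => expUnit ζ • p) ζ w = vertField J w (expUnit ζ • p) := by
  have htranslate : (fun ζ => expUnit ζ • p) =
      (fun z : ℂˣ => z • expUnit ζ • p) ∘ expUnit ∘ fun ζ' => ζ' - ζ := by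
    ext ζ'
    rw [Function.comp_apply, Function.comp_apply, smul_smul, ← expUnit_add, sub_add_cancel]
  have hsub : MDifferentiableAt 𝓘(ℝ, ℂ) 𝓘(ℝ, ℂ) (fun ζ' : ℂ => ζ' - ζ) ζ :=
    (differentiableAt_id.sub_const ζ).mdifferentiableAt
  have hexp : MDifferentiableAt 𝓘(ℝ, ℂ) 𝓘(ℝ, ℂ) expUnit 0 :=
    (contMDiff_expUnit 0).mdifferentiableAt (by simp)
  have horbit := (hπ.contMDiff_smul_const (expUnit ζ • p) 1).mdifferentiableAt (by simp)
  have hzero : expUnit (ζ - ζ) = 1 := by rw [sub_self, expUnit_zero]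
  have hmfderiv_sub : mfderiv 𝓘(ℝ, ℂ) 𝓘(ℝ, ℂ) (fun ζ' : ℂ => ζ' - ζ) ζ w = w := by
    rw [mfderiv_eq_fderiv, fderiv_sub_const, fderiv_fun_id]
    rfl
  have houter := mfderiv_comp_apply_of_eq ζ horbit (hexp.comp_of_eq ζ hsub (sub_self ζ)) hzero w
  have hinner := mfderiv_comp_apply_of_eq ζ hexp hsub (sub_self ζ) w
  refine (DFunLike.congr_fun (mfderiv_congr (I := 𝓘(ℝ, ℂ)) (I' := J) (x := ζ) htranslate)
    w).trans (houter.trans (congrArg (mfderiv 𝓘(ℝ, ℂ) J _ 1) (hinner.trans ?_)))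
  exact (congrArg (mfderiv 𝓘(ℝ, ℂ) 𝓘(ℝ, ℂ) expUnit 0) hmfderiv_sub).trans (mfderiv_expUnit_zero w)

section ExpUnitSMul

variable {ℓ : N → ℂ} {S : N → P} {x : N}

theorem mfderiv_expUnit_smul (hℓ : MDifferentiableAt I' 𝓘(ℝ, ℂ) ℓ x)
    (hS : MDifferentiableAt I' J S x) (u : TangentSpace I' x) :
    mfderiv I' J (fun y => expUnit (ℓ y) • S y) x u =
      vertField J (mvfderiv I' ℓ x u) (expUnit (ℓ x) • S x) +
        mfderiv J J (fun q : P => expUnit (ℓ x) • q) (S x) (mfderiv I' J S x u) := by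
  have hsmul : MDifferentiableAt (𝓘(ℝ, ℂ).prod J) J (fun q : ℂ × P => expUnit q.1 • q.2)
      (ℓ x, S x) := (hπ.contMDiff_expUnit_smul _).mdifferentiableAt (by simp)
  have hcomp := DFunLike.congr_fun (mfderiv_comp x hsmul (hℓ.prodMk hS)) u
  have hprod := DFunLike.congr_fun (mfderiv_prodMk hℓ hS) u
  refine hcomp.trans ((congrArg (mfderiv (𝓘(ℝ, ℂ).prod J) J _ (ℓ x, S x)) hprod).trans
    ((mfderiv_prod_eq_add_apply hsmul).trans ?_))
  exact congrArg (· + _) (hπ.mfderiv_expUnit_smul_const (S x) (ℓ x) _)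

theorem form_mfderiv_expUnit_smul [IsManifold J 1 P] (A : ConnectionForm J P)
    (hℓ : MDifferentiableAt I' 𝓘(ℝ, ℂ) ℓ x)
    (hS : MDifferentiableAt I' J S x) (u : TangentSpace I' x) :
    A.form (expUnit (ℓ x) • S x) (mfderiv I' J (fun y => expUnit (ℓ y) • S y) x u) =
      (mvfderiv I' ℓ x u + A.form (S x) (mfderiv I' J S x u) : ℂ) := by
  rw [hπ.mfderiv_expUnit_smul hℓ hS, map_add, A.form_vertField, A.form_smul]

end ExpUnitSMul

/-- Near `p`, the identity is `q ↦ expUnit (ℓ q) • s (π q)` for a local section `s`; the derivative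
of the second factor along a vertical vector vanishes. -/
theorem eq_vertField [IsManifold J 1 P] (A : ConnectionForm J P) {p : P} {u : TangentSpace J p}
    (hu : mfderiv J I π p u = 0) :
    vertField J (A.form p u) p = u := by
  obtain ⟨s, hs, -, hℓ⟩ := hπ.exists_localSection (π p)
  obtain ⟨ℓ, hℓ, hexp⟩ := hℓ p rfl
  have hπp := (hπ.contMDiff_proj p).mdifferentiableAt (by simp)
  have hsp := hs.mdifferentiableAt (by simp)
  have hid : mfderiv J J (fun q => expUnit (ℓ q) • s (π q)) p u = u :=
    (DFunLike.congr_fun (Filter.EventuallyEq.mfderiv_eq (I := J) (I' := J)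
      (f₁ := fun q => expUnit (ℓ q) • s (π q)) (f := id) hexp) u).trans
      (DFunLike.congr_fun (mfderiv_id (I := J) (x := p)) u)
  have hprod := hπ.mfderiv_expUnit_smul (hℓ.mdifferentiableAt (by simp)) (hsp.comp p hπp) u
  have hs_vert : mfderiv J J (s ∘ π) p u = 0 :=
    (mfderiv_comp_apply p hsp hπp u).trans ((congrArg (mfderiv I J s (π p)) hu).trans (map_zero _))
  obtain ⟨c, rfl⟩ : ∃ c, vertField J c p = u := by
    refine ⟨mvfderiv J ℓ p u, .trans ?_ (hprod.symm.trans hid)⟩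
    rw [hs_vert, map_zero, add_zero, Function.comp_apply, hexp.self_of_nhds]
  rw [A.form_vertField]

theorem pullbackForm_expUnit_smul [IsManifold J 1 P] (A : ConnectionForm J P) {ℓ : E' → ℂ}
    {S : E' → P} {y : E'}
    (hℓ : DifferentiableAt ℝ ℓ y) (hS : MDifferentiableAt 𝓘(ℝ, E') J S y) :
    pullbackForm J (F := ℂ) A.form (fun y => expUnit (ℓ y) • S y) y =
      fderiv ℝ ℓ y + pullbackForm J (F := ℂ) A.form S y := by
  ext u
  have h := hπ.form_mfderiv_expUnit_smul A hℓ.mdifferentiableAt hS u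
  rw [mvfderiv, mfderiv_eq_fderiv] at h
  exact h

section Curvature

variable [J.Boundaryless] [IsManifold J ∞ P] (A : ConnectionForm J P)

theorem extDerivLinear_pullbackForm_expUnit_smul
    {ℓ : E' → ℂ} {S : E' → P} {y : E'}
    (hℓ : ContDiffAt ℝ 2 ℓ y) (hS : ContMDiffAt 𝓘(ℝ, E') J 2 S y) :
    extDerivLinear (pullbackForm J (F := ℂ) A.form (fun y => expUnit (ℓ y) • S y)) y =
      extDerivLinear (pullbackForm J (F := ℂ) A.form S) y := by
  have hev : pullbackForm J (F := ℂ) A.form (fun y => expUnit (ℓ y) • S y) =ᶠ[𝓝 y]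
      fun z => fderiv ℝ ℓ z + pullbackForm J (F := ℂ) A.form S z := by
    filter_upwards [hℓ.eventually (by simp), (contMDiffAt_iff_contMDiffAt_nhds (by simp)).1 hS]
      with z hℓz hSz
    exact hπ.pullbackForm_expUnit_smul A (hℓz.differentiableAt two_ne_zero)
      (hSz.mdifferentiableAt two_ne_zero)
  rw [extDerivLinear_congr hev]
  exact extDerivLinear_fderiv_add hℓ minSmoothness_of_isRCLikeNormedField.le
    (differentiableAt_pullbackForm hS (A.differentiableAt_pullbackForm_extChartAt_symm _))

/-- The form `A` differs from its pullback along `s ∘ π`, for a local section `s`, by the closed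
form `dℓ`. -/
theorem extDerivOneForm_eq_mfderiv_localSection {p : P} {s : M → P} {ℓ : P → ℂ}
    (hs : ContMDiffAt I J ∞ s (π p)) (hℓ : ContMDiffAt J 𝓘(ℝ, ℂ) ∞ ℓ p)
    (hexp : ∀ᶠ q in 𝓝 p, expUnit (ℓ q) • s (π q) = q) (u v : TangentSpace J p) :
    extDerivOneForm J A.form p u v = extDerivOneForm J A.form (s (π p))
      (mfderiv I J s (π p) (mfderiv J I π p u)) (mfderiv I J s (π p) (mfderiv J I π p v)) := by
  have hchart : ContMDiffAt 𝓘(ℝ, EP) J ∞ (extChartAt J p).symm (extChartAt J p p) :=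
    contMDiffAt_extChartAt_symm (mem_extChartAt_target p)
  have hℓ' := (hℓ.comp_of_eq hchart (extChartAt_to_inv p)).contDiffAt
  have hsπ : ContMDiffAt J J ∞ (s ∘ π) p := hs.comp p (hπ.contMDiff_proj p)
  have hS := hsπ.comp_of_eq hchart (extChartAt_to_inv p)
  have hev : pullbackForm J (F := ℂ) A.form (extChartAt J p).symm =ᶠ[𝓝 (extChartAt J p p)]
      pullbackForm J (F := ℂ) A.form fun y =>
        expUnit ((ℓ ∘ (extChartAt J p).symm) y) • ((s ∘ π) ∘ (extChartAt J p).symm) y := by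
    have h := (continuousAt_extChartAt_symm (I := J) p).eventually
      (by rwa [extChartAt_to_inv] : ∀ᶠ q in 𝓝 _, expUnit (ℓ q) • s (π q) = q)
    filter_upwards [h.eventually_nhds] with y hy
    exact pullbackForm_congr A.form (hy.mono fun z hz => hz.symm)
  refine (DFunLike.congr_fun (DFunLike.congr_fun ((extDerivLinear_congr hev).trans
    (hπ.extDerivLinear_pullbackForm_expUnit_smul A (hℓ'.of_le (by norm_cast))
      (hS.of_le (by norm_cast)))) u) v).trans ?_
  refine (extDerivLinear_pullbackForm_comp_extChartAt_symm (hsπ.of_le (by norm_cast))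
    (A.differentiableAt_pullbackForm_extChartAt_symm _) u v).trans ?_
  have hdsπ := mfderiv_comp_apply p (hs.mdifferentiableAt (by simp))
    ((hπ.contMDiff_proj p).mdifferentiableAt (by simp))
  exact congrArg₂ (extDerivOneForm J A.form (s (π p))) (hdsπ u) (hdsπ v)

theorem exists_isCurvature :
    ∃ F : ∀ x : M, TangentSpace I x →L[ℝ] TangentSpace I x →L[ℝ] ℂ, IsCurvature I J π A F := by
  choose s hs _ hexp using hπ.exists_localSection
  let D (x : M) : EM →L[ℝ] EP := mfderiv I J (s x) x
  let dA (q : P) : EP →L[ℝ] EP →L[ℝ] ℂ :=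
    extDerivLinear (pullbackForm J A.form (extChartAt J q).symm) (extChartAt J q q)
  let F (x : M) : EM →L[ℝ] EM →L[ℝ] ℂ := (dA (s x x)).bilinearComp (D x) (D x)
  refine ⟨F, fun p u v => ?_⟩
  obtain ⟨ℓ, hℓ, hexp⟩ := hexp (π p) p rfl
  exact (hπ.extDerivOneForm_eq_mfderiv_localSection A (hs _) hℓ hexp u v).symm

end Curvature

theorem isCurvature_unique [IsManifold J 1 P] {A : ConnectionForm J P}
    {F F' : ∀ x : M, TangentSpace I x →L[ℝ] TangentSpace I x →L[ℝ] ℂ}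
    (hF : IsCurvature I J π A F) (hF' : IsCurvature I J π A F') : F = F' := by
  ext x u v
  obtain ⟨p, rfl, hsurj⟩ := hπ.exists_proj_eq_surjective_mfderiv x
  obtain ⟨⟨u, rfl⟩, v, rfl⟩ := And.intro (hsurj u) (hsurj v)
  exact (hF p u v).trans (hF' p u v).symm

theorem exists_contMDiffMap_comp_proj {f : P → ℂ} (hf : ContMDiff J 𝓘(ℝ, ℂ) ∞ f)
    (hinv : ∀ (z : ℂˣ) (p : P), f (z • p) = f p) :
    ∃ g : C^∞⟮I, M; 𝓘(ℝ, ℂ), ℂ⟯, ∀ p, g (π p) = f p := by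
  have hfactor : Function.FactorsThrough f π := fun p q hpq => by
    obtain ⟨s, -, -, hs⟩ := hπ.exists_localSection (π q)
    obtain ⟨_, -, hp⟩ := hs p hpq
    obtain ⟨_, -, hq⟩ := hs q rfl
    rw [← hp.self_of_nhds, ← hq.self_of_nhds, hinv, hinv, hpq]
  obtain ⟨g, rfl⟩ : ∃ g, f = g ∘ π := (Function.factorsThrough_iff f).1 hfactor
  refine ⟨⟨g, fun x => ?_⟩, fun p => rfl⟩
  obtain ⟨s, hs, hπs, -⟩ := hπ.exists_localSection x
  refine ((hf _).comp x hs).congr_of_eventuallyEq ?_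
  filter_upwards [hπs] with y hy
  rw [Function.comp_apply, Function.comp_apply, hy]

end IsPrincipalCStarBundle
end PrincipalBundle

section LieCochain

variable {EG : Type*} [NormedAddCommGroup EG] [NormedSpace ℝ EG] [CompleteSpace EG]
  {HG : Type*} [TopologicalSpace HG] {IG : ModelWithCorners ℝ EG HG} [IG.Boundaryless]
  {G : Type*} [TopologicalSpace G] [T2Space G] [ChartedSpace HG G] [Group G] [LieGroup IG ∞ G]
  {EM : Type*} [NormedAddCommGroup EM] [NormedSpace ℝ EM]
  {HM : Type*} [TopologicalSpace HM] {I : ModelWithCorners ℝ EM HM}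
  {M : Type*} [TopologicalSpace M] [ChartedSpace HM M] [MulAction Gᵐᵒᵖ M]
  (hact : ContMDiff (I.prod IG) I ∞ (fun q : M × G => q.1 <• q.2))
include hact

theorem lieAct_eq_mvfderiv_of_contMDiff (ξ : GroupLieAlgebra IG G) (f : C^∞⟮I, M; 𝓘(ℝ, ℂ), ℂ⟯)
    (x : M) : lieAct ξ f x = mvfderiv I f x (fundField I ξ x) :=
  lieAct_eq_mvfderiv (mdifferentiableAt_orbitMap (n := ∞) (a := fun (x : M) (g : G) => x <• g)
    (hact (x, 1)) (by simp)) ((f.contMDiff x).mdifferentiableAt (by simp)) ξ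

variable [I.Boundaryless] [IsManifold I ∞ M]

theorem contMDiff_lieAct (ξ : GroupLieAlgebra IG G) (f : C^∞⟮I, M; 𝓘(ℝ, ℂ), ℂ⟯) :
    ContMDiff I 𝓘(ℝ, ℂ) ∞ (lieAct ξ f) := by
  have : IsManifold IG ∞ G := inferInstance
  rw [funext (lieAct_eq_mvfderiv_of_contMDiff hact ξ f)]
  have hfund (x : M) : ContDiffAt ℝ ∞ (vfChart I (fundField I ξ) x) (extChartAt I x x) :=
    contDiffAt_vfChart_orbitField (n := ∞) (a := fun (x : M) (g : G) => x <• g) le_rfl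
      (fun x => by simp only [MulOpposite.op_one, one_smul]) (fun y => hact (y, 1)) x ξ
  exact fun x => contMDiffAt_mvfderiv_apply (n := ∞) le_rfl (f.contMDiff x) (hfund x)

/-- The representation of `Lie(G)` on the smooth functions on `M`, as a bilinear map. -/
noncomputable def lieActBilinear : GroupLieAlgebra IG G →ₗ[ℝ]
    C^∞⟮I, M; 𝓘(ℝ, ℂ), ℂ⟯ →ₗ[ℝ] C^∞⟮I, M; 𝓘(ℝ, ℂ), ℂ⟯ :=
  have hlie := lieAct_eq_mvfderiv_of_contMDiff hact
  have hf (f : C^∞⟮I, M; 𝓘(ℝ, ℂ), ℂ⟯) (x : M) : MDifferentiableAt I 𝓘(ℝ, ℂ) f x :=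
    (f.contMDiff x).mdifferentiableAt (by simp)
  LinearMap.mk₂ ℝ (fun ξ f => ⟨lieAct ξ f, contMDiff_lieAct hact ξ f⟩)
    (fun ξ η f => ContMDiffMap.ext fun x => (hlie (ξ + η) f x).trans <|
      ((congrArg (mvfderiv I f x) (map_add (mfderiv IG I (fun g : G => x <• g) 1) ξ η)).trans
        (map_add _ _ _)).trans (congrArg₂ (· + ·) (hlie ξ f x) (hlie η f x)).symm)
    (fun c ξ f => ContMDiffMap.ext fun x => (hlie (c • ξ) f x).trans <|
      ((congrArg (mvfderiv I f x) (map_smul (mfderiv IG I (fun g : G => x <• g) 1) c ξ)).trans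
        (map_smul _ _ _)).trans (congrArg (c • ·) (hlie ξ f x)).symm)
    (fun ξ f g => ContMDiffMap.ext fun x => (hlie ξ (f + g) x).trans <|
      (DFunLike.congr_fun (mvfderiv_add (hf f x) (hf g x)) _).trans
        (congrArg₂ (· + ·) (hlie ξ f x) (hlie ξ g x)).symm)
    (fun c ξ f => ContMDiffMap.ext fun x => (hlie ξ (c • f) x).trans <|
      (DFunLike.congr_fun (const_smul_mfderiv (hf f x) c) _).trans
        (congrArg (c • ·) (hlie ξ f x)).symm)

/-- The Chevalley–Eilenberg coboundary of a `1`-cochain on `Lie(G)` with values in the smooth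
functions on `M`. -/
noncomputable def lieCoboundary (b : GroupLieAlgebra IG G →ₗ[ℝ] C^∞⟮I, M; 𝓘(ℝ, ℂ), ℂ⟯) :
    GroupLieAlgebra IG G →ₗ[ℝ] GroupLieAlgebra IG G →ₗ[ℝ] C^∞⟮I, M; 𝓘(ℝ, ℂ), ℂ⟯ :=
  have : LieGroup IG (minSmoothness ℝ 3) G := LieGroup.of_le (n := ∞)
    (by simp only [minSmoothness_of_isRCLikeNormedField]; exact ENat.LEInfty.out)
  let bracket : GroupLieAlgebra IG G →ₗ[ℝ] GroupLieAlgebra IG G →ₗ[ℝ] GroupLieAlgebra IG G :=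
    LieModule.toEnd ℝ (GroupLieAlgebra IG G) (GroupLieAlgebra IG G)
  let action := (lieActBilinear hact).compl₂ b
  action - action.flip - bracket.compr₂ b

theorem lieCoboundary_apply (b : GroupLieAlgebra IG G →ₗ[ℝ] C^∞⟮I, M; 𝓘(ℝ, ℂ), ℂ⟯)
    (ξ η : GroupLieAlgebra IG G) (x : M) :
    lieCoboundary hact b ξ η x = lieAct ξ (b η) x - lieAct η (b ξ) x - b ⁅ξ, η⁆ x :=
  rfl

end LieCochain

section SectionCocycle

open VectorField

variable {EG : Type*} [NormedAddCommGroup EG] [NormedSpace ℝ EG]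
  {HG : Type*} [TopologicalSpace HG] {IG : ModelWithCorners ℝ EG HG}
  {G : Type*} [TopologicalSpace G] [ChartedSpace HG G] [Group G]
  {EM : Type*} [NormedAddCommGroup EM] [NormedSpace ℝ EM]
  {HM : Type*} [TopologicalSpace HM] {I : ModelWithCorners ℝ EM HM}
  {M : Type*} [MulAction Gᵐᵒᵖ M]
  {EP : Type*} [NormedAddCommGroup EP] [NormedSpace ℝ EP]
  {HP : Type*} [TopologicalSpace HP] {J : ModelWithCorners ℝ EP HP}
  {P : Type*} [TopologicalSpace P] [ChartedSpace HP P] [MulAction ℂˣ P]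
  {π : P → M}

namespace LocalSection

/-- The local right action `p ↦ p σ(g)` on the total space defined by a local section `σ`. -/
noncomputable def act (σ : LocalSection IG G J π) (p : P) (g : G) : P := (σ.toFun g).diffeo p

variable (σ : LocalSection IG G J π)

theorem act_one (p : P) : σ.act p 1 = p := by
  rw [act, σ.map_one]
  rfl

theorem contMDiffAt_act (p : P) :
    ContMDiffAt (J.prod IG) J ∞ (fun q : P × G => σ.act q.1 q.2) (p, 1) :=
  σ.contMDiffOn.contMDiffAt ((isOpen_univ.prod σ.isOpen_dom).mem_nhds ⟨mem_univ _, σ.one_mem_dom⟩)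

theorem mdifferentiableAt_act (p : P) : MDifferentiableAt IG J (σ.act p) 1 :=
  mdifferentiableAt_orbitMap (σ.contMDiffAt_act p) (by simp)

section Smooth

variable [IG.Boundaryless] [LieGroup IG ∞ G] [J.Boundaryless] [IsManifold J ∞ P]

theorem contDiffAt_vfChart_field (ξ : GroupLieAlgebra IG G) (p : P) :
    ContDiffAt ℝ ∞ (vfChart J (σ.field ξ) p) (extChartAt J p p) := by
  have : IsManifold IG ∞ G := inferInstance
  exact contDiffAt_vfChart_orbitField (n := ∞) le_rfl σ.act_one σ.contMDiffAt_act p ξ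

theorem differentiableAt_vfChart_field (ξ : GroupLieAlgebra IG G) (p : P) :
    DifferentiableAt ℝ (vfChart J (σ.field ξ) p) (extChartAt J p p) :=
  (σ.contDiffAt_vfChart_field ξ p).differentiableAt (by simp)

theorem contMDiff_form_field (A : ConnectionForm J P) (ξ : GroupLieAlgebra IG G) :
    ContMDiff J 𝓘(ℝ, ℂ) ∞ (fun p => (A.form p (σ.field ξ p) : ℂ)) := fun p =>
  contMDiffAt_form_apply (A.contDiffAt_pullbackForm_extChartAt_symm p)
    (σ.contDiffAt_vfChart_field ξ p)

theorem hasMixedDeriv_mlieBracket [CompleteSpace EG] [T2Space G] (ξ η : GroupLieAlgebra IG G)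
    (p : P) :
    HasMixedDeriv J
      (fun t s => (σ.toFun (expCurve ξ t) * σ.toFun (expCurve η s) *
        σ.toFun (expCurve ξ (-t)) * σ.toFun (expCurve η (-s))).diffeo p)
      p (mlieBracket J (σ.field ξ) (σ.field η) p) := by
  have : IsManifold IG 2 G := .of_le (n := ∞) (by norm_cast)
  have : IsManifold J 2 P := .of_le (n := ∞) (by norm_cast)
  exact hasMixedDeriv_commutator σ.act_one (fun p => (σ.contMDiffAt_act p).of_le (by norm_cast)) p
    (expCurve_zero ξ) (expCurve_zero η) (hasMFDerivAt_expCurve ξ 0).continuousAt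
    (hasMFDerivAt_expCurve η 0).continuousAt (hasDerivAt_extChartAt_expCurve ξ)
    (hasDerivAt_extChartAt_expCurve η)

end Smooth

variable [TopologicalSpace M] [ChartedSpace HM M]

theorem mfderiv_proj_field (hπ : IsPrincipalCStarBundle I J π) (ξ : GroupLieAlgebra IG G) (p : P) :
    mfderiv J I π p (σ.field ξ p) = fundField I ξ (π p) := by
  have hcovers : π ∘ σ.act p =ᶠ[𝓝 1] fun g : G => π p <• g := by
    filter_upwards [σ.isOpen_dom.mem_nhds σ.one_mem_dom] with g hg
    have h := (σ.toFun g).covers p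
    rwa [σ.base_toFun g hg] at h
  exact (mfderiv_comp_apply_of_eq (1 : G) ((hπ.contMDiff_proj p).mdifferentiableAt (by simp))
    (σ.mdifferentiableAt_act p) (σ.act_one p) ξ).symm.trans
    (DFunLike.congr_fun (hcovers.mfderiv_eq (I := IG) (I' := I)) ξ)

theorem field_const_smul (hπ : IsPrincipalCStarBundle I J π) (ξ : GroupLieAlgebra IG G) (z : ℂˣ)
    (p : P) : σ.field ξ (z • p) = mfderiv J J (fun q : P => z • q) p (σ.field ξ p) := by
  have hequivariant : σ.act (z • p) = (fun q : P => z • q) ∘ σ.act p :=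
    funext fun g => (σ.toFun g).equivariant z p
  exact (DFunLike.congr_fun (mfderiv_congr (I := IG) (I' := J) (x := 1) hequivariant) ξ).trans
    (mfderiv_comp_apply_of_eq (1 : G)
      ((hπ.contMDiff_const_smul z p).mdifferentiableAt (by simp)) (σ.mdifferentiableAt_act p)
      (σ.act_one p) ξ)

theorem isConnectionCochain_unique [IsManifold J 1 P] (hπ : IsPrincipalCStarBundle I J π)
    {A : ConnectionForm J P} {b b' : GroupLieAlgebra IG G →ₗ[ℝ] C^∞⟮I, M; 𝓘(ℝ, ℂ), ℂ⟯}
    (hb : σ.IsConnectionCochain A b) (hb' : σ.IsConnectionCochain A b') : b = b' := by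
  ext ξ x
  obtain ⟨p, rfl⟩ := hπ.surjective_proj x
  exact (hb ξ p).trans (hb' ξ p).symm

theorem isSectionCocycle_unique [CompleteSpace EG] [IG.Boundaryless] [LieGroup IG ∞ G] [T2Space G]
    [IsManifold J 1 P] (hπ : IsPrincipalCStarBundle I J π) (A : ConnectionForm J P)
    {om om' : GroupLieAlgebra IG G →ₗ[ℝ] GroupLieAlgebra IG G →ₗ[ℝ] C^∞⟮I, M; 𝓘(ℝ, ℂ), ℂ⟯}
    (hom : σ.IsSectionCocycle om) (hom' : σ.IsSectionCocycle om') : om = om' := by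
  ext ξ η x
  obtain ⟨p, rfl⟩ := hπ.surjective_proj x
  have h := congrArg (A.form p) (add_left_cancel ((hom ξ η p).unique (hom' ξ η p)))
  rwa [A.form_vertField, A.form_vertField] at h

theorem extDerivOneForm_field [IsManifold J 1 P] (hπ : IsPrincipalCStarBundle I J π)
    {A : ConnectionForm J P} {F : ∀ x : M, TangentSpace I x →L[ℝ] TangentSpace I x →L[ℝ] ℂ}
    (hF : IsCurvature I J π A F) (ξ η : GroupLieAlgebra IG G) (p : P) :
    extDerivOneForm J A.form p (σ.field ξ p) (σ.field η p) =
      F (π p) (fundField I ξ (π p)) (fundField I η (π p)) := by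
  rw [← hF p, σ.mfderiv_proj_field hπ, σ.mfderiv_proj_field hπ]

theorem mvfderiv_form_field [CompleteSpace EG] [IG.Boundaryless] [LieGroup IG ∞ G] [T2Space G]
    [IsManifold J 1 P] (hπ : IsPrincipalCStarBundle I J π)
    (hact : ContMDiff (I.prod IG) I ∞ (fun q : M × G => q.1 <• q.2)) {A : ConnectionForm J P}
    {b : GroupLieAlgebra IG G →ₗ[ℝ] C^∞⟮I, M; 𝓘(ℝ, ℂ), ℂ⟯} (hb : σ.IsConnectionCochain A b)
    (ξ η : GroupLieAlgebra IG G) (p : P) :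
    mvfderiv J (fun q => (A.form q (σ.field η q) : ℂ)) p (σ.field ξ p) =
      lieAct ξ (b η) (π p) := by
  have hdescend : (fun q => (A.form q (σ.field η q) : ℂ)) = b η ∘ π :=
    funext fun q => (hb η q).symm
  rw [hdescend, lieAct_eq_mvfderiv_of_contMDiff hact]
  refine (mfderiv_comp_apply p (((b η).contMDiff (π p)).mdifferentiableAt (by simp))
    ((hπ.contMDiff_proj p).mdifferentiableAt (by simp)) _).trans ?_
  exact congrArg (mvfderiv I (b η) (π p)) (σ.mfderiv_proj_field hπ ξ p)

section Cocycle

variable [IG.Boundaryless] [LieGroup IG ∞ G] [J.Boundaryless] [IsManifold J ∞ P]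
  (hπ : IsPrincipalCStarBundle I J π)
include hπ

theorem exists_isConnectionCochain (A : ConnectionForm J P) :
    ∃ b : GroupLieAlgebra IG G →ₗ[ℝ] C^∞⟮I, M; 𝓘(ℝ, ℂ), ℂ⟯, σ.IsConnectionCochain A b := by
  have hinv (ξ : GroupLieAlgebra IG G) (z : ℂˣ) (p : P) :
      A.form (z • p) (σ.field ξ (z • p)) = A.form p (σ.field ξ p) := by
    rw [σ.field_const_smul hπ, A.form_smul]
  choose b hb using fun ξ => hπ.exists_contMDiffMap_comp_proj (σ.contMDiff_form_field A ξ) (hinv ξ)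
  refine ⟨{ toFun := b, map_add' := fun ξ η => ?_, map_smul' := fun c ξ => ?_ }, hb⟩
  · ext x
    obtain ⟨p, rfl⟩ := hπ.surjective_proj x
    refine (hb _ p).trans <| (congrArg (A.form p)
      (map_add (mfderiv IG J (σ.act p) 1) ξ η)).trans <| (map_add _ _ _).trans ?_
    exact (congrArg₂ (· + ·) (hb ξ p) (hb η p)).symm
  · ext x
    obtain ⟨p, rfl⟩ := hπ.surjective_proj x
    refine (hb _ p).trans <| (congrArg (A.form p)
      (map_smul (mfderiv IG J (σ.act p) 1) c ξ)).trans <| (map_smul _ _ _).trans ?_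
    exact (congrArg (c • ·) (hb ξ p)).symm

theorem mfderiv_proj_mlieBracket [I.Boundaryless] [IsManifold I 2 M]
    (hact : ContMDiff (I.prod IG) I 2 (fun q : M × G => q.1 <• q.2)) (ξ η : GroupLieAlgebra IG G)
    (p : P) :
    mfderiv J I π p (mlieBracket J (σ.field ξ) (σ.field η) p) = fundField I ⁅ξ, η⁆ (π p) := by
  have : IsManifold IG 2 G := .of_le (n := ∞) (by norm_cast)
  have : IsManifold J 2 P := .of_le (n := ∞) (by norm_cast)
  have hfund (ξ : GroupLieAlgebra IG G) (x : M) :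
      DifferentiableAt ℝ (vfChart I (fundField I ξ) x) (extChartAt I x x) :=
    differentiableAt_vfChart_orbitField (a := fun (x : M) (g : G) => x <• g)
      (fun x => by simp only [MulOpposite.op_one, one_smul]) (fun x => hact (x, 1)) x ξ
  exact (mfderiv_mlieBracket_of_related (hπ.contMDiff_proj.of_le (by norm_cast))
    (σ.differentiableAt_vfChart_field ξ p) (σ.differentiableAt_vfChart_field η p)
    (hfund ξ _) (hfund η _) (σ.mfderiv_proj_field hπ ξ) (σ.mfderiv_proj_field hπ η)).trans
    (mlieBracket_fundField hact ξ η (π p))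

variable {A : ConnectionForm J P} {F : ∀ x : M, TangentSpace I x →L[ℝ] TangentSpace I x →L[ℝ] ℂ}
  (hF : IsCurvature I J π A F)
include hF

include σ in
theorem exists_curvatureCochain :
    ∃ K : GroupLieAlgebra IG G →ₗ[ℝ] GroupLieAlgebra IG G →ₗ[ℝ] C^∞⟮I, M; 𝓘(ℝ, ℂ), ℂ⟯,
      ∀ ξ η x, K ξ η x = F x (fundField I ξ x) (fundField I η x) := by
  let fund (x : M) : GroupLieAlgebra IG G →L[ℝ] TangentSpace I x :=
    mfderiv IG I (fun g : G => x <• g) 1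
  let pullback (x : M) : GroupLieAlgebra IG G →ₗ[ℝ] GroupLieAlgebra IG G →ₗ[ℝ] ℂ :=
    LinearMap.mk₂ ℝ (fun ξ η => F x (fund x ξ) (fund x η))
      (fun ξ ξ' η => by simp) (fun c ξ η => by simp) (fun ξ η η' => by simp) (fun c ξ η => by simp)
  have hsmooth (ξ η : GroupLieAlgebra IG G) :
      ContMDiff J 𝓘(ℝ, ℂ) ∞ (fun p => pullback (π p) ξ η) := by
    have : IsManifold J 2 P := .of_le (n := ∞) (by norm_cast)
    exact ContMDiff.congr (fun p => contMDiffAt_extDerivOneForm_apply (n := ∞) le_rfl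
      A.contDiffAt_pullbackForm_extChartAt_symm (σ.contDiffAt_vfChart_field ξ p)
      (σ.contDiffAt_vfChart_field η p)) fun p => (σ.extDerivOneForm_field hπ hF ξ η p).symm
  choose K hK using fun ξ η => hπ.exists_contMDiffMap_comp_proj (hsmooth ξ η) fun z p =>
    congrArg (fun x => pullback x ξ η) (hπ.proj_smul z p)
  have hpullback (ξ η : GroupLieAlgebra IG G) (x : M) : K ξ η x = pullback x ξ η := by
    obtain ⟨p, rfl⟩ := hπ.surjective_proj x
    exact hK ξ η p
  refine ⟨LinearMap.mk₂ ℝ K (fun ξ ξ' η => ?_) (fun c ξ η => ?_) (fun ξ η η' => ?_)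
    fun c ξ η => ?_, hpullback⟩ <;> ext x <;>
  simp only [hpullback, ContMDiffMap.coe_add, Pi.add_apply, ContMDiffMap.coe_smul, Pi.smul_apply,
    map_add, map_smul, LinearMap.add_apply, LinearMap.smul_apply]

variable [CompleteSpace EG] [T2Space G] {b : GroupLieAlgebra IG G →ₗ[ℝ] C^∞⟮I, M; 𝓘(ℝ, ℂ), ℂ⟯}
  (hb : σ.IsConnectionCochain A b)
  (hact : ContMDiff (I.prod IG) I ∞ (fun q : M × G => q.1 <• q.2))
include hb hact

theorem form_mlieBracket_field (ξ η : GroupLieAlgebra IG G) (p : P) :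
    A.form p (mlieBracket J (σ.field ξ) (σ.field η) p) =
      lieAct ξ (b η) (π p) - lieAct η (b ξ) (π p) -
        F (π p) (fundField I ξ (π p)) (fundField I η (π p)) := by
  have : IsManifold J 2 P := .of_le (n := ∞) (by norm_cast)
  have hdA := extDerivOneForm_apply_vectorField (A.differentiableAt_pullbackForm_extChartAt_symm p)
    (σ.differentiableAt_vfChart_field ξ p) (σ.differentiableAt_vfChart_field η p)
    ((σ.contMDiff_form_field A ξ p).mdifferentiableAt (by simp))
    ((σ.contMDiff_form_field A η p).mdifferentiableAt (by simp))
  rw [σ.extDerivOneForm_field hπ hF, σ.mvfderiv_form_field hπ hact hb,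
    σ.mvfderiv_form_field hπ hact hb] at hdA
  rw [hdA, sub_sub_cancel]

variable [I.Boundaryless] [IsManifold I ∞ M]

theorem isSectionCocycle_lieCoboundary_sub
    {K : GroupLieAlgebra IG G →ₗ[ℝ] GroupLieAlgebra IG G →ₗ[ℝ] C^∞⟮I, M; 𝓘(ℝ, ℂ), ℂ⟯}
    (hK : ∀ ξ η x, K ξ η x = F x (fundField I ξ x) (fundField I η x)) :
    σ.IsSectionCocycle (lieCoboundary hact b - K) := by
  intro ξ η p
  have : IsManifold I 2 M := .of_le (n := ∞) (by norm_cast)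
  let v := mlieBracket J (σ.field ξ) (σ.field η) p
  have hker : mfderiv J I π p (v - σ.field ⁅ξ, η⁆ p) = 0 := by
    rw [map_sub, σ.mfderiv_proj_mlieBracket hπ (hact.of_le (by norm_cast)),
      σ.mfderiv_proj_field hπ, sub_self]
  have hform : (lieCoboundary hact b - K) ξ η (π p) = A.form p (v - σ.field ⁅ξ, η⁆ p) := by
    have hv := σ.form_mlieBracket_field hπ hF hb hact ξ η p
    refine Eq.symm (((A.form p).map_sub _ _).trans
      ((congrArg₂ (fun x y : ℂ => x - y) hv (hb ⁅ξ, η⁆ p).symm).trans ?_))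
    rw [LinearMap.sub_apply, LinearMap.sub_apply, ContMDiffMap.coe_sub, Pi.sub_apply,
      lieCoboundary_apply, hK]
    ring
  have hvertical : v = σ.field ⁅ξ, η⁆ p + vertField J ((lieCoboundary hact b - K) ξ η (π p)) p := by
    rw [hform]
    exact ((congrArg (σ.field ⁅ξ, η⁆ p + ·) (hπ.eq_vertField A hker)).trans
      (add_sub_cancel _ v)).symm
  exact hvertical ▸ σ.hasMixedDeriv_mlieBracket ξ η p

end Cocycle

end LocalSection

end SectionCocycle

theorem mainTheorem2_general
    {EG : Type*} [NormedAddCommGroup EG] [NormedSpace ℝ EG] [CompleteSpace EG]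
    {HG : Type*} [TopologicalSpace HG] {IG : ModelWithCorners ℝ EG HG} [IG.Boundaryless]
    {G : Type*} [TopologicalSpace G] [T2Space G] [ChartedSpace HG G] [Group G] [LieGroup IG ∞ G]
    {EM : Type*} [NormedAddCommGroup EM] [NormedSpace ℝ EM]
    {HM : Type*} [TopologicalSpace HM] {I : ModelWithCorners ℝ EM HM} [I.Boundaryless]
    {M : Type*} [TopologicalSpace M] [ChartedSpace HM M] [IsManifold I ∞ M]
    [MulAction Gᵐᵒᵖ M]
    {EP : Type*} [NormedAddCommGroup EP] [NormedSpace ℝ EP]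
    {HP : Type*} [TopologicalSpace HP] {J : ModelWithCorners ℝ EP HP} [J.Boundaryless]
    {P : Type*} [TopologicalSpace P] [ChartedSpace HP P] [IsManifold J ∞ P]
    [MulAction ℂˣ P]
    (hact : ContMDiff (I.prod IG) I ∞ (fun q : M × G => q.1 <• q.2))
    (π : P → M) (hπ : IsPrincipalCStarBundle I J π)
    (A : ConnectionForm J P) (σ : LocalSection IG G J π) :
    (∃! F : ∀ x : M, TangentSpace I x →L[ℝ] TangentSpace I x →L[ℝ] ℂ, IsCurvature I J π A F) ∧
    (∃! b : GroupLieAlgebra IG G →ₗ[ℝ] C^∞⟮I, M; 𝓘(ℝ, ℂ), ℂ⟯, σ.IsConnectionCochain A b) ∧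
    (∃! om : GroupLieAlgebra IG G →ₗ[ℝ] GroupLieAlgebra IG G →ₗ[ℝ] C^∞⟮I, M; 𝓘(ℝ, ℂ), ℂ⟯,
      σ.IsSectionCocycle om) ∧
    ∀ (F : ∀ x : M, TangentSpace I x →L[ℝ] TangentSpace I x →L[ℝ] ℂ)
      (b : GroupLieAlgebra IG G →ₗ[ℝ] C^∞⟮I, M; 𝓘(ℝ, ℂ), ℂ⟯)
      (omA : GroupLieAlgebra IG G →ₗ[ℝ] GroupLieAlgebra IG G →ₗ[ℝ] C^∞⟮I, M; 𝓘(ℝ, ℂ), ℂ⟯),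
      IsCurvature I J π A F → σ.IsConnectionCochain A b → σ.IsSectionCocycle omA →
      ∀ (ξ η : GroupLieAlgebra IG G) (x : M),
        omA ξ η x = -F x (fundField I ξ x) (fundField I η x)
          + lieAct ξ (b η) x - lieAct η (b ξ) x - b ⁅ξ, η⁆ x := by
  obtain ⟨F, hF⟩ := hπ.exists_isCurvature A
  obtain ⟨b, hb⟩ := σ.exists_isConnectionCochain hπ A
  obtain ⟨K, hK⟩ := σ.exists_curvatureCochain hπ hF
  have hom := σ.isSectionCocycle_lieCoboundary_sub hπ hF hb hact hK
  refine ⟨⟨F, hF, fun F' hF' => hπ.isCurvature_unique hF' hF⟩,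
    ⟨b, hb, fun b' hb' => σ.isConnectionCochain_unique hπ hb' hb⟩,
    ⟨lieCoboundary hact b - K, hom, fun om' hom' => σ.isSectionCocycle_unique hπ A hom' hom⟩,
    fun F' b' omA hF' hb' homA ξ η x => ?_⟩
  rw [σ.isSectionCocycle_unique hπ A homA hom, hπ.isCurvature_unique hF' hF,
    σ.isConnectionCochain_unique hπ hb' hb, LinearMap.sub_apply, LinearMap.sub_apply,
    ContMDiffMap.coe_sub, Pi.sub_apply, lieCoboundary_apply, hK]
  ring

theorem mainTheorem2
    {EG : Type*} [NormedAddCommGroup EG] [NormedSpace ℝ EG] [CompleteSpace EG]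
    {HG : Type*} [TopologicalSpace HG] {IG : ModelWithCorners ℝ EG HG} [IG.Boundaryless]
    {G : Type*} [TopologicalSpace G] [T2Space G] [ChartedSpace HG G] [Group G] [LieGroup IG ∞ G]
    {EM : Type*} [NormedAddCommGroup EM] [NormedSpace ℝ EM] [CompleteSpace EM]
    {HM : Type*} [TopologicalSpace HM] {I : ModelWithCorners ℝ EM HM} [I.Boundaryless]
    {M : Type*} [TopologicalSpace M] [T2Space M] [ChartedSpace HM M] [IsManifold I ∞ M]
    [MulAction Gᵐᵒᵖ M]
    {EP : Type*} [NormedAddCommGroup EP] [NormedSpace ℝ EP] [CompleteSpace EP]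
    {HP : Type*} [TopologicalSpace HP] {J : ModelWithCorners ℝ EP HP} [J.Boundaryless]
    {P : Type*} [TopologicalSpace P] [T2Space P] [ChartedSpace HP P] [IsManifold J ∞ P]
    [MulAction ℂˣ P]
    (hact : ContMDiff (I.prod IG) I ∞ (fun q : M × G => q.1 <• q.2))
    (π : P → M) (hπ : IsPrincipalCStarBundle I J π)
    (A : ConnectionForm J P) (σ : LocalSection IG G J π) :
    (∃! F : ∀ x : M, TangentSpace I x →L[ℝ] TangentSpace I x →L[ℝ] ℂ, IsCurvature I J π A F) ∧
    (∃! b : GroupLieAlgebra IG G →ₗ[ℝ] C^∞⟮I, M; 𝓘(ℝ, ℂ), ℂ⟯, σ.IsConnectionCochain A b) ∧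
    (∃! om : GroupLieAlgebra IG G →ₗ[ℝ] GroupLieAlgebra IG G →ₗ[ℝ] C^∞⟮I, M; 𝓘(ℝ, ℂ), ℂ⟯,
      σ.IsSectionCocycle om) ∧
    ∀ (F : ∀ x : M, TangentSpace I x →L[ℝ] TangentSpace I x →L[ℝ] ℂ)
      (b : GroupLieAlgebra IG G →ₗ[ℝ] C^∞⟮I, M; 𝓘(ℝ, ℂ), ℂ⟯)
      (omA : GroupLieAlgebra IG G →ₗ[ℝ] GroupLieAlgebra IG G →ₗ[ℝ] C^∞⟮I, M; 𝓘(ℝ, ℂ), ℂ⟯),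
      IsCurvature I J π A F → σ.IsConnectionCochain A b → σ.IsSectionCocycle omA →
      ∀ (ξ η : GroupLieAlgebra IG G) (x : M),
        omA ξ η x = -F x (fundField I ξ x) (fundField I η x)
          + lieAct ξ (b η) x - lieAct η (b ξ) x - b ⁅ξ, η⁆ x :=
  mainTheorem2_general hact π hπ A σ
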